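/- Write $D_s=\{\xi\in\mathbb C:|\xi|<s\}$ and $D=D_1$. For a closed disk $E=\overline{D_s}$ let $H(E)$ be the set of functions analytic in a neighbourhood of $E$, and let $O(E)$ be the set of $f\in H(E)$ that are univalent (analytic and injective) in a neighbourhood of $E$ with $f(0)=0$ and $f'(0)>0$. For $b\ge 0$, $f\in C^1([0,b],H(E))$ means that there are an open set $U\supseteq E$ on which all $f(\cdot,t)$, $0\le t\le b$, are analytic and functions $f_t(\cdot,t)$ analytic on $U$ such that $f_t$ is the derivative of $t\mapsto f(\cdot,t)$ on $[0,b]$ (one-sided at the end points) and $t\mapsto f_t(\cdot,t)$ is continuous, both with respect to uniform convergence on $U$. Let $I=[0,b]$ or $I=[0,b)$ with $b>0$. A strong solution on $I$ of the Polubarinova–Galin equation (injection case) is a function $f(\xi,t)$ such that $f(\cdot,t)\in O(\overline D)$ for every $t\in I$, $f$ is continuously differentiable in $t\in I$ (that is, $f\in C^1([0,T],H(\overline D))$ for every $T\in I$), and $$\operatorname{Re}\left[f_t(\xi,t)\,\overline{\xi f'(\xi,t)}\right]=1\qquad(|\xi|=1,\ t\in I),$$ where $f'=\partial f/\partial\xi$.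 **Theorem.** (a) Let $\rho_0>r>1$ and let $f_0$ be analytic in a neighbourhood of $\overline{D_{\rho_0}}$ and injective on $\overline{D_r}$, with $f_0(0)=0$ and $f_0'(0)>0$. Then for every $r'$ with $1<r'<r$ there are $b>0$ and a strong solution $f$ on $[0,b]$ with $f(\cdot,0)=f_0$ on $\overline{D_{r'}}$, $f\in C^1([0,b],H(\overline{D_{r'}}))$, and $f(\cdot,t)\in O(\overline{D_{r'}})$ for all $t\in[0,b]$. (b) Consequently, for every $f_0\in O(\overline D)$ there are $b>0$ and a strong solution $f$ on $[0,b)$ with $f(\cdot,0)=f_0$ on $\overline D$. -/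

import Mathlib

namespace HeleShaw

/-- The closed disk of radius `r` centred at the origin. -/
def closedDisk (r : ℝ) : Set ℂ := Metric.closedBall (0 : ℂ) r

/-- Functions analytic on `E`, i.e. in a neighbourhood of every point of `E`. -/
def H (E : Set ℂ) : Set (ℂ → ℂ) := {f | AnalyticOnNhd ℂ f E}

/-- The normalization `f(0) = 0` and `f'(0) > 0` (a positive real number). -/
def Normalized (f : ℂ → ℂ) : Prop :=
  f 0 = 0 ∧ (deriv f 0).im = 0 ∧ 0 < (deriv f 0).re

/-- Normalized functions that are analytic and univalent in a neighbourhood of `E`. -/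
def O (E : Set ℂ) : Set (ℂ → ℂ) :=
  {f | (∃ U : Set ℂ, IsOpen U ∧ E ⊆ U ∧ AnalyticOnNhd ℂ f U ∧ Set.InjOn f U) ∧ Normalized f}

/-- `f ∈ C¹([0,T], H(E))` for compact `E`: on one common open neighbourhood `U` of `E` all the
`f t` are analytic, and `t ↦ f t` has a time derivative `g` on `[0,T]` (one-sided at the end
points) that is again analytic on `U` and continuous in `t`; both limits are uniform on `U`. -/
def IsC1 (T : ℝ) (E : Set ℂ) (f : ℝ → ℂ → ℂ) : Prop :=
  ∃ U : Set ℂ, IsOpen U ∧ E ⊆ U ∧ ∃ g : ℝ → ℂ → ℂ, ∀ t ∈ Set.Icc 0 T,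
    AnalyticOnNhd ℂ (f t) U ∧ AnalyticOnNhd ℂ (g t) U ∧
    TendstoUniformlyOn (fun (s : ℝ) (z : ℂ) => (f s z - f t z) / ((s - t : ℝ) : ℂ)) (g t)
      (nhdsWithin t (Set.Icc 0 T \ {t})) U ∧
    TendstoUniformlyOn g (g t) (nhdsWithin t (Set.Icc 0 T)) U

/-- `f` is a strong solution of the Polubarinova–Galin equation (injection case) on the time
interval `I`, which is to be `[0,b)` or `[0,b]`. -/
structure IsStrongSolution (I : Set ℝ) (f : ℝ → ℂ → ℂ) : Prop where
  univalent : ∀ t ∈ I, f t ∈ O (closedDisk 1)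
  contDiff : ∀ T ∈ I, IsC1 T (closedDisk 1) f
  equation : ∀ t ∈ I, ∀ ξ : ℂ, ‖ξ‖ = 1 →
    (derivWithin (fun s : ℝ => f s ξ) I t *
      (starRingEnd ℂ) (deriv (f t) ξ * ξ)).re = 1

end HeleShaw

namespace HeleShaw

open Set Filter Topology

/-! Put p = 1/f'. On |ξ| = 1 the equation reads Re(f_t/(ξ f')) = |p|², so f_t = ξ h/p, where h is
analytic, Re h = |p|² on the circle and h(0) is real. Differentiating in ξ gives p_t = ξ(h p' - p
h') - h p. The Taylor coefficients of h are the sums Σ p_{j+m} conj(p_m), doubled for j > 0, so this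
is a cubic system for the coefficients of p, free of division, which loses one derivative.

The loss is absorbed as in the Cauchy–Kovalevskaya theorem. On disks of shrinking radius s(t) = s₀
exp(-Lt) the quantities u_n = p_n s(t)^n acquire the damping -L n u_n, and the Duhamel integral
gains back the factor n + 1 at the price ε = b + 1/L (`decayIntegral_bound`). For small b and large
L the integral equation is a contraction on absolutely summable sequences of continuous functions of
time (`exists_cubic_fixedPoint`, `exists_coeff_solution`).

Given p, the function f = f₀ + ∫ ξ h/p dτ satisfies f' = 1/p
(`IsReciprocalSolution.hasDerivAt_evolution`), hence the original equation. Since p stays uniformly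
close to 1/f₀', f' stays close to f₀', and univalence persists on a smaller disk by a reverse
Lipschitz bound for f₀ (`exists_mul_norm_sub_le_of_injOn`, `injOn_of_deriv_close`). -/

/-! ### Univalent functions and stability of univalence. -/

theorem deriv_ne_zero_of_injOn {f : ℂ → ℂ} {B : Set ℂ} (hB : IsOpen B) (hBc : IsPreconnected B)
    (hf : AnalyticOnNhd ℂ f B) (hinj : InjOn f B) {a : ℂ} (ha : a ∈ B) : deriv f a ≠ 0 := by
  have hopen : ∀ s ⊆ B, IsOpen s → IsOpen (f '' s) := by
    rcases hf.is_constant_or_isOpen hBc with ⟨w, hw⟩ | h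
    · exfalso
      have h1 : ∀ᶠ z in 𝓝[≠] a, z ∈ B := nhdsWithin_le_nhds (hB.mem_nhds ha)
      obtain ⟨z, hz, hza⟩ := (h1.and self_mem_nhdsWithin).exists
      exact hza (hinj hz ha ((hw z hz).trans (hw a ha).symm))
    · exact h
  set g := Function.invFunOn f B with hg
  have hgf : ∀ z ∈ B, g (f z) = z := fun z hz => hinj.leftInvOn_invFunOn hz
  have hVo : IsOpen (f '' B) := hopen B subset_rfl hB
  have hfg : ∀ y ∈ f '' B, f (g y) = y := by
    rintro _ ⟨z, hz, rfl⟩; rw [hgf z hz]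
  have hgc : ∀ z ∈ B, ContinuousAt g (f z) := by
    intro z hz
    rw [ContinuousAt, hgf z hz]
    intro W hW
    obtain ⟨W', hW', hWo, hzW⟩ := mem_nhds_iff.1 hW
    have : f '' (W' ∩ B) ∈ 𝓝 (f z) :=
      (hopen _ inter_subset_right (hWo.inter hB)).mem_nhds ⟨z, ⟨hzW, hz⟩, rfl⟩
    rw [mem_map]
    filter_upwards [this]
    rintro _ ⟨w, ⟨hw, hwB⟩, rfl⟩
    simpa [hgf w hwB] using hW' hw
  have hgd : ∀ z ∈ B, deriv f z ≠ 0 → DifferentiableAt ℂ g (f z) := by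
    intro z hz hd
    have h1 : HasDerivAt f (deriv f z) (g (f z)) := by
      rw [hgf z hz]; exact (hf z hz).differentiableAt.hasDerivAt
    refine (HasDerivAt.of_local_left_inverse (hgc z hz) h1 hd ?_).differentiableAt
    filter_upwards [hVo.mem_nhds ⟨z, hz, rfl⟩] with y hy using hfg y hy
  have hiso : ∀ᶠ z in 𝓝[≠] a, deriv f z ≠ 0 := by
    rcases (hf a ha).deriv.eventually_eq_zero_or_eventually_ne_zero with h | h
    · exfalso
      obtain ⟨ε, hε, hb⟩ := Metric.mem_nhds_iff.1 (inter_mem h (hB.mem_nhds ha))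
      have hab : a ∈ Metric.ball a ε := Metric.mem_ball_self hε
      have h1 : ∀ᶠ z in 𝓝[≠] a, z ∈ Metric.ball a ε :=
        nhdsWithin_le_nhds (Metric.ball_mem_nhds a hε)
      obtain ⟨z, hz, hza⟩ := (h1.and self_mem_nhdsWithin).exists
      refine hza (hinj (hb hz).2 ha ?_)
      refine (convex_ball a ε).is_const_of_fderivWithin_eq_zero (𝕜 := ℂ) ?_ ?_ hz hab
      · exact fun w hw => (hf w (hb hw).2).differentiableAt.differentiableWithinAt
      · intro w hw
        rw [fderivWithin_of_isOpen Metric.isOpen_ball hw]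
        ext
        simpa using (hb hw).1
    · exact h
  -- The zeros of f' are isolated, so the continuous inverse g is differentiable on a punctured
  -- neighbourhood of f(a), and the singularity is removable. The chain rule for g ∘ f = id then
  -- excludes f'(a) = 0.
  have hga : DifferentiableAt ℂ g (f a) := by
    obtain ⟨ε, hε, hb⟩ := Metric.mem_nhds_iff.1
      (inter_mem (mem_nhdsWithin_iff_eventually.1 hiso) (hB.mem_nhds ha))
    set s := f '' Metric.ball a ε with hs
    have hso : IsOpen s := hopen _ (fun z hz => (hb hz).2) Metric.isOpen_ball
    have has : s ∈ 𝓝 (f a) := hso.mem_nhds ⟨a, Metric.mem_ball_self hε, rfl⟩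
    have := (Complex.differentiableOn_compl_singleton_and_continuousAt_iff has).1
      ⟨?_, hgc a ha⟩
    · exact this.differentiableAt has
    · rintro _ ⟨⟨z, hz, rfl⟩, hza⟩
      refine (hgd z (hb hz).2 ((hb hz).1 ?_)).differentiableWithinAt
      rintro rfl; exact hza rfl
  intro h0
  have h1 : HasDerivAt (g ∘ f) (deriv g (f a) * deriv f a) a :=
    hga.hasDerivAt.comp a (hf a ha).differentiableAt.hasDerivAt
  have h2 : HasDerivAt (g ∘ f) 1 a :=
    (hasDerivAt_id a).congr_of_eventuallyEq (by
      filter_upwards [hB.mem_nhds ha] with z hz using hgf z hz)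
  have := h1.unique h2
  simp [h0] at this

/-- An injective analytic function satisfies a reverse Lipschitz bound on compact sets. -/
theorem exists_mul_norm_sub_le_of_injOn {f : ℂ → ℂ} {B K : Set ℂ} (hB : IsOpen B)
    (hBc : IsPreconnected B) (hf : AnalyticOnNhd ℂ f B) (hinj : InjOn f B) (hK : IsCompact K)
    (hKB : K ⊆ B) : ∃ c > 0, ∀ z ∈ K, ∀ w ∈ K, c * ‖z - w‖ ≤ ‖f z - f w‖ := by
  suffices h : ∃ c > 0, ∀ q ∈ K ×ˢ K, c * ‖q.1 - q.2‖ ≤ ‖f q.1 - f q.2‖ by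
    obtain ⟨c, hc, h⟩ := h
    exact ⟨c, hc, fun z hz w hw => h (z, w) ⟨hz, hw⟩⟩
  -- By compactness of K × K it suffices to find a constant near each pair (a, b); a finite union
  -- takes the minimum.
  refine (hK.prod hK).induction_on
    (p := fun S => ∃ c > 0, ∀ q ∈ S, c * ‖q.1 - q.2‖ ≤ ‖f q.1 - f q.2‖) ?_ ?_ ?_ ?_
  · exact ⟨1, one_pos, by simp⟩
  · rintro s t hst ⟨c, hc, h⟩
    exact ⟨c, hc, fun q hq => h q (hst hq)⟩
  · rintro s t ⟨c, hc, h⟩ ⟨d, hd, h'⟩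
    refine ⟨min c d, lt_min hc hd, ?_⟩
    rintro q (hq | hq)
    · exact (mul_le_mul_of_nonneg_right (min_le_left _ _) (norm_nonneg _)).trans (h q hq)
    · exact (mul_le_mul_of_nonneg_right (min_le_right _ _) (norm_nonneg _)).trans (h' q hq)
  · rintro ⟨a, b⟩ ⟨ha, hb⟩
    suffices h : ∃ c > 0, ∀ᶠ q : ℂ × ℂ in 𝓝 (a, b), c * ‖q.1 - q.2‖ ≤ ‖f q.1 - f q.2‖ by
      obtain ⟨c, hc, h⟩ := h
      exact ⟨_, nhdsWithin_le_nhds h, c, hc, fun q hq => hq⟩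
    have hd := (hf a (hKB ha)).hasStrictDerivAt
    by_cases hab : a = b
    -- On the diagonal strict differentiability with f'(a) ≠ 0 gives the constant |f'(a)|/2; off it,
    -- continuity gives half the difference quotient.
    · subst hab
      have h0 := norm_pos_iff.2 (deriv_ne_zero_of_injOn hB hBc hf hinj (hKB ha))
      refine ⟨‖deriv f a‖ / 2, by positivity, ?_⟩
      filter_upwards [hd.isLittleO.def (half_pos h0)] with q hq
      have h1 : ‖(q.1 - q.2) • deriv f a‖ ≤ ‖f q.1 - f q.2‖ +
          ‖f q.1 - f q.2 - (q.1 - q.2) • deriv f a‖ := by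
        have := norm_sub_le (f q.1 - f q.2) (f q.1 - f q.2 - (q.1 - q.2) • deriv f a)
        simpa using this
      rw [norm_smul] at h1
      simp only [ContinuousLinearMap.toSpanSingleton_apply] at hq
      linarith
    · have hfab : 0 < ‖f a - f b‖ :=
        norm_pos_iff.2 (sub_ne_zero.2 fun h => hab (hinj (hKB ha) (hKB hb) h))
      have hab' : 0 < ‖a - b‖ := norm_pos_iff.2 (sub_ne_zero.2 hab)
      have hca : ContinuousAt (fun q : ℂ × ℂ => f q.1) (a, b) :=
        ContinuousAt.comp (f := Prod.fst) (hf a (hKB ha)).continuousAt continuousAt_fst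
      have hcb : ContinuousAt (fun q : ℂ × ℂ => f q.2) (a, b) :=
        ContinuousAt.comp (f := Prod.snd) (hf b (hKB hb)).continuousAt continuousAt_snd
      set c := ‖f a - f b‖ / (2 * ‖a - b‖) with hc
      refine ⟨c, by positivity, ?_⟩
      have h1 : ContinuousAt (fun q : ℂ × ℂ => c * ‖q.1 - q.2‖) (a, b) := by fun_prop
      have h2 : ContinuousAt (fun q : ℂ × ℂ => ‖f q.1 - f q.2‖) (a, b) := (hca.sub hcb).norm
      have h3 : c * ‖a - b‖ < ‖f a - f b‖ := by
        rw [hc]; field_simp; linarith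
      filter_upwards [h1.eventually_lt h2 h3] with q hq using hq.le

/-- Injectivity on a convex set is stable under small perturbations of the derivative. -/
theorem injOn_of_deriv_close {f₀ f : ℂ → ℂ} {f₀' f' : ℂ → ℂ} {V : Set ℂ} {c η : ℝ}
    (hV : Convex ℝ V)
    (hc : ∀ z ∈ V, ∀ w ∈ V, c * ‖z - w‖ ≤ ‖f₀ z - f₀ w‖)
    (hf₀ : ∀ z ∈ V, HasDerivAt f₀ (f₀' z) z) (hf : ∀ z ∈ V, HasDerivAt f (f' z) z)
    (hη : ∀ z ∈ V, ‖f' z - f₀' z‖ ≤ η) (hηc : η < c) : InjOn f V := by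
  intro z hz w hw hzw
  have h1 : ‖(f z - f₀ z) - (f w - f₀ w)‖ ≤ η * ‖z - w‖ :=
    hV.norm_image_sub_le_of_norm_hasDerivWithin_le
      (fun x hx => ((hf x hx).sub (hf₀ x hx)).hasDerivWithinAt) hη hw hz
  have h2 : (f z - f₀ z) - (f w - f₀ w) = -(f₀ z - f₀ w) := by rw [hzw]; ring
  rw [h2, norm_neg] at h1
  have h3 := (hc z hz w hw).trans h1
  by_contra hne
  have h4 : 0 < ‖z - w‖ := norm_pos_iff.2 (sub_ne_zero.2 hne)
  exact absurd (le_of_mul_le_mul_right h3 h4) (not_le.2 hηc)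

/-! ### The cubic fixed-point equation in absolutely summable sequences. -/

section AbstractFixedPoint

set_option linter.unusedSectionVars false

variable {E : Type*} [NormedCommRing E] [StarRing E] [NormedStarGroup E] [NormedAlgebra ℂ E]
  [CompleteSpace E]

/-- Weighted coefficients of the analytic function whose real part on the unit circle is the real
part of `u * conj v`. -/
noncomputable def herglotzCoeff (ρ u v : ℕ → E) (j : ℕ) : E :=
  (if j = 0 then (1 : ℂ) else 2) • ∑' m, u (j + m) * star (v m) * ρ m

/-- The coefficients of `h θu - u θh - h u`, where `θ = ξ d/dξ`. -/
noncomputable def transportCoeff (h u : ℕ → E) (n : ℕ) : E :=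
  ∑ x ∈ Finset.HasAntidiagonal.antidiagonal n, ((x.2 : ℂ) - x.1 - 1) • (h x.1 * u x.2)

/-- The map (j, m) ↦ (j + m, m) is injective, so this is a subseries of the product double series.
-/
theorem summable_shift_mul {a b : ℕ → ℝ} (ha : Summable a) (hb : Summable b) (ha0 : ∀ n, 0 ≤ a n)
    (hb0 : ∀ n, 0 ≤ b n) : Summable (fun x : ℕ × ℕ => a (x.1 + x.2) * b x.2) ∧
      ∑' x : ℕ × ℕ, a (x.1 + x.2) * b x.2 ≤ (∑' n, a n) * ∑' n, b n := by
  have hab : Summable (fun x : ℕ × ℕ => a x.1 * b x.2) := ha.mul_of_nonneg hb ha0 hb0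
  have hi : Function.Injective (fun x : ℕ × ℕ => (x.1 + x.2, x.2)) := by
    rintro ⟨i, j⟩ ⟨k, l⟩ h
    simp only [Prod.mk.injEq] at h ⊢
    omega
  have hs : Summable (fun x : ℕ × ℕ => a (x.1 + x.2) * b x.2) := hab.comp_injective hi
  refine ⟨hs, ?_⟩
  rw [ha.tsum_mul_tsum hb hab]
  exact hs.tsum_le_tsum_of_inj _ hi (fun _ _ => mul_nonneg (ha0 _) (hb0 _)) (fun _ => le_rfl) hab

theorem norm_shift_mul_le {ρ : ℕ → E} (hρ : ∀ m, ‖ρ m‖ ≤ 1) (u v : ℕ → E) (j m : ℕ) :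
    ‖u (j + m) * star (v m) * ρ m‖ ≤ ‖u (j + m)‖ * ‖v m‖ := by
  calc ‖u (j + m) * star (v m) * ρ m‖ ≤ ‖u (j + m) * star (v m)‖ * ‖ρ m‖ := norm_mul_le _ _
    _ ≤ ‖u (j + m) * star (v m)‖ * 1 := by gcongr; exact hρ m
    _ ≤ ‖u (j + m)‖ * ‖v m‖ := by
      rw [mul_one, ← norm_star (v m)]; exact norm_mul_le _ _

theorem summable_herglotz_aux {ρ : ℕ → E} (hρ : ∀ m, ‖ρ m‖ ≤ 1) {u v : ℕ → E}
    (hu : Summable fun n => ‖u n‖) (hv : Summable fun n => ‖v n‖) (j : ℕ) :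
    Summable (fun m => u (j + m) * star (v m) * ρ m) := by
  have h := (summable_shift_mul hu hv (fun _ => norm_nonneg _) (fun _ => norm_nonneg _)).1
  exact Summable.of_norm_bounded (h.prod_factor j) (norm_shift_mul_le hρ u v j)

theorem herglotzCoeff_norm {ρ : ℕ → E} (hρ : ∀ m, ‖ρ m‖ ≤ 1) {u v : ℕ → E}
    (hu : Summable fun n => ‖u n‖) (hv : Summable fun n => ‖v n‖) :
    (Summable fun j => ‖herglotzCoeff ρ u v j‖) ∧
      ∑' j, ‖herglotzCoeff ρ u v j‖ ≤ 2 * ((∑' n, ‖u n‖) * ∑' n, ‖v n‖) := by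
  obtain ⟨h1, h2⟩ := summable_shift_mul hu hv (fun _ => norm_nonneg _) (fun _ => norm_nonneg _)
  have hb : ∀ j, ‖herglotzCoeff ρ u v j‖ ≤ 2 * ∑' m, ‖u (j + m)‖ * ‖v m‖ := by
    intro j
    rw [herglotzCoeff, norm_smul]
    have h3 : ‖∑' m, u (j + m) * star (v m) * ρ m‖ ≤ ∑' m, ‖u (j + m)‖ * ‖v m‖ :=
      tsum_of_norm_bounded (h1.prod_factor j).hasSum
        (norm_shift_mul_le hρ u v j)
    refine mul_le_mul ?_ h3 (norm_nonneg _) zero_le_two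
    split_ifs <;> norm_num
  have hs : Summable fun j => 2 * ∑' m, ‖u (j + m)‖ * ‖v m‖ := h1.prod.mul_left 2
  have hs' := Summable.of_nonneg_of_le (fun _ => norm_nonneg _) hb hs
  refine ⟨hs', (hs'.tsum_le_tsum hb hs).trans ?_⟩
  rw [tsum_mul_left]
  rw [h1.tsum_prod] at h2
  linarith

/-- The factor n + 1 is the derivative lost through θ; it bounds the weight |k - j - 1| when j + k =
n. -/
theorem norm_transportCoeff_le (h u : ℕ → E) (n : ℕ) :
    ‖transportCoeff h u n‖ ≤ (n + 1) * ∑ x ∈ Finset.HasAntidiagonal.antidiagonal n, ‖h x.1‖ * ‖u x.2‖ := by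
  rw [transportCoeff, Finset.mul_sum]
  refine norm_sum_le_of_le _ fun x hx => ?_
  rw [norm_smul]
  have hx' : x.1 + x.2 = n := by simpa using hx
  have h1 : ‖(x.2 : ℂ) - x.1 - 1‖ ≤ n + 1 := by
    have : (x.2 : ℂ) - x.1 - 1 = (((x.2 : ℝ) - x.1 - 1 : ℝ) : ℂ) := by push_cast; ring
    rw [this, Complex.norm_real, Real.norm_eq_abs, abs_le]
    have h2 : (x.1 : ℝ) + x.2 = n := by exact_mod_cast hx'
    have h3 : (0 : ℝ) ≤ x.1 := by positivity
    have h4 : (0 : ℝ) ≤ x.2 := by positivity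
    constructor <;> linarith
  exact mul_le_mul h1 (norm_mul_le _ _) (norm_nonneg _) (by positivity)

theorem transport_norm {J : ℕ → E →+ E} {ε : ℝ} (hε : 0 ≤ ε)
    (hJ : ∀ n g, (n + 1) * ‖J n g‖ ≤ ε * ‖g‖) {h u : ℕ → E}
    (hh : Summable fun n => ‖h n‖) (hu : Summable fun n => ‖u n‖) :
    (Summable fun n => ‖J n (transportCoeff h u n)‖) ∧
      ∑' n, ‖J n (transportCoeff h u n)‖ ≤ ε * ((∑' n, ‖h n‖) * ∑' n, ‖u n‖) := by
  have hm : Summable (fun x : ℕ × ℕ => ‖h x.1‖ * ‖u x.2‖) :=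
    hh.mul_of_nonneg hu (fun _ => norm_nonneg _) (fun _ => norm_nonneg _)
  have hs := (summable_sum_mul_antidiagonal_of_summable_mul (f := fun n => ‖h n‖)
    (g := fun n => ‖u n‖) hm).mul_left ε
  have hb : ∀ n, ‖J n (transportCoeff h u n)‖ ≤
      ε * ∑ x ∈ Finset.HasAntidiagonal.antidiagonal n, ‖h x.1‖ * ‖u x.2‖ := by
    intro n
    have h1 := hJ n (transportCoeff h u n)
    have h2 := mul_le_mul_of_nonneg_left (norm_transportCoeff_le h u n) hε
    have h3 : (0 : ℝ) < n + 1 := by positivity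
    refine le_of_mul_le_mul_left ?_ h3
    linarith
  have hs' := Summable.of_nonneg_of_le (fun _ => norm_nonneg _) hb hs
  refine ⟨hs', (hs'.tsum_le_tsum hb hs).trans ?_⟩
  rw [tsum_mul_left, Summable.tsum_mul_tsum_eq_tsum_sum_antidiagonal (f := fun n => ‖h n‖)
    (g := fun n => ‖u n‖) hh hu hm]

theorem herglotzCoeff_sub_left {ρ : ℕ → E} (hρ : ∀ m, ‖ρ m‖ ≤ 1) {u u' v : ℕ → E}
    (hu : Summable fun n => ‖u n‖) (hu' : Summable fun n => ‖u' n‖)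
    (hv : Summable fun n => ‖v n‖) :
    herglotzCoeff ρ (u - u') v = herglotzCoeff ρ u v - herglotzCoeff ρ u' v := by
  ext j
  simp only [herglotzCoeff, Pi.sub_apply, ← smul_sub,
    ← (summable_herglotz_aux hρ hu hv j).tsum_sub (summable_herglotz_aux hρ hu' hv j), sub_mul]

theorem herglotzCoeff_sub_right {ρ : ℕ → E} (hρ : ∀ m, ‖ρ m‖ ≤ 1) {u v v' : ℕ → E}
    (hu : Summable fun n => ‖u n‖) (hv : Summable fun n => ‖v n‖)
    (hv' : Summable fun n => ‖v' n‖) :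
    herglotzCoeff ρ u (v - v') = herglotzCoeff ρ u v - herglotzCoeff ρ u v' := by
  ext j
  simp only [herglotzCoeff, Pi.sub_apply, ← smul_sub, star_sub,
    ← (summable_herglotz_aux hρ hu hv j).tsum_sub (summable_herglotz_aux hρ hu hv' j), sub_mul,
    mul_sub]

theorem transportCoeff_sub_left (h h' u : ℕ → E) (n : ℕ) :
    transportCoeff (h - h') u n = transportCoeff h u n - transportCoeff h' u n := by
  simp only [transportCoeff, Pi.sub_apply, sub_mul, smul_sub, Finset.sum_sub_distrib]

theorem transportCoeff_sub_right (h u u' : ℕ → E) (n : ℕ) :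
    transportCoeff h (u - u') n = transportCoeff h u n - transportCoeff h u' n := by
  simp only [transportCoeff, Pi.sub_apply, mul_sub, smul_sub, Finset.sum_sub_distrib]

theorem cubic_norm {J : ℕ → E →+ E} {ε : ℝ} (hε : 0 ≤ ε)
    (hJ : ∀ n g, (n + 1) * ‖J n g‖ ≤ ε * ‖g‖) {ρ : ℕ → E} (hρ : ∀ m, ‖ρ m‖ ≤ 1) {u v w : ℕ → E}
    (hu : Summable fun n => ‖u n‖) (hv : Summable fun n => ‖v n‖) (hw : Summable fun n => ‖w n‖) :
    (Summable fun n => ‖J n (transportCoeff (herglotzCoeff ρ u v) w n)‖) ∧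
      ∑' n, ‖J n (transportCoeff (herglotzCoeff ρ u v) w n)‖ ≤
        2 * ε * ((∑' n, ‖u n‖) * (∑' n, ‖v n‖) * ∑' n, ‖w n‖) := by
  obtain ⟨h1, h2⟩ := herglotzCoeff_norm hρ hu hv
  obtain ⟨h3, h4⟩ := transport_norm hε hJ h1 hw
  refine ⟨h3, h4.trans ?_⟩
  have h5 : 0 ≤ ∑' n, ‖w n‖ := tsum_nonneg fun _ => norm_nonneg _
  calc ε * ((∑' n, ‖herglotzCoeff ρ u v n‖) * ∑' n, ‖w n‖)
      ≤ ε * ((2 * ((∑' n, ‖u n‖) * ∑' n, ‖v n‖)) * ∑' n, ‖w n‖) := by gcongr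
    _ = _ := by ring

/-- Absolutely summable sequences. -/
abbrev EllOne (E : Type*) [NormedAddCommGroup E] := lp (fun _ : ℕ => E) 1

theorem lp_one_norm (u : EllOne E) : ‖u‖ = ∑' n, ‖u n‖ := by
  simpa using lp.norm_eq_tsum_rpow (p := 1) (by simp) u

theorem lp_one_summable (u : EllOne E) : Summable fun n => ‖u n‖ := by
  simpa using (lp.memℓp u).summable (by simp)

/-- Banach's theorem on the ℓ¹ ball of radius δ about u₀, where norms are at most M + δ. The cubic
term has norm at most 2ε times the cube of the norm, so `h1` keeps the ball invariant. Its increment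
is a sum of three trilinear terms, so `h2` gives the Lipschitz constant 1/2. -/
theorem exists_cubic_fixedPoint {J : ℕ → E →+ E} {ε M δ : ℝ} (hε : 0 ≤ ε)
    (hJ : ∀ n g, (n + 1) * ‖J n g‖ ≤ ε * ‖g‖) {ρ : ℕ → E} (hρ : ∀ m, ‖ρ m‖ ≤ 1) {u₀ : ℕ → E}
    (hu₀ : Summable fun n => ‖u₀ n‖) (hM : ∑' n, ‖u₀ n‖ ≤ M) (hδ : 0 ≤ δ)
    (h1 : 2 * ε * (M + δ) ^ 3 ≤ δ) (h2 : 6 * ε * (M + δ) ^ 2 ≤ 1 / 2) :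
    ∃ u : ℕ → E, (Summable fun n => ‖u n‖) ∧ ∑' n, ‖u n - u₀ n‖ ≤ δ ∧
      ∀ n, u n = u₀ n + J n (transportCoeff (herglotzCoeff ρ u u) u n) := by
  have hM0 : 0 ≤ M := (tsum_nonneg fun _ => norm_nonneg _).trans hM
  have hmem : ∀ {v : ℕ → E}, (Summable fun n => ‖v n‖) → Memℓp v (1 : ENNReal) := fun hv =>
    memℓp_gen (by simpa using hv)
  let U₀ : EllOne E := ⟨u₀, hmem hu₀⟩
  let T : EllOne E → EllOne E := fun u =>
    ⟨fun n => J n (transportCoeff (herglotzCoeff ρ u u) u n), hmem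
      (cubic_norm hε hJ hρ (lp_one_summable u) (lp_one_summable u) (lp_one_summable u)).1⟩
  let Φ : EllOne E → EllOne E := fun u => U₀ + T u
  have hR : ∀ u ∈ Metric.closedBall U₀ δ, ‖u‖ ≤ M + δ := by
    intro u hu
    have hU : ‖U₀‖ ≤ M := by rw [lp_one_norm]; exact hM
    have := norm_le_norm_add_norm_sub' u U₀
    rw [mem_closedBall_iff_norm] at hu
    linarith
  have hTn : ∀ u ∈ Metric.closedBall U₀ δ, ‖T u‖ ≤ δ := by
    intro u hu
    have hs := lp_one_summable u
    have h3 := (cubic_norm hε hJ hρ hs hs hs).2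
    rw [lp_one_norm]
    refine h3.trans (le_trans ?_ h1)
    rw [← lp_one_norm]
    have := hR u hu
    calc 2 * ε * (‖u‖ * ‖u‖ * ‖u‖) ≤ 2 * ε * ((M + δ) * (M + δ) * (M + δ)) := by gcongr
      _ = _ := by ring
  have hmaps : MapsTo Φ (Metric.closedBall U₀ δ) (Metric.closedBall U₀ δ) := by
    intro u hu
    rw [mem_closedBall_iff_norm]
    simpa [Φ] using hTn u hu
  have hlip : ∀ u ∈ Metric.closedBall U₀ δ, ∀ v ∈ Metric.closedBall U₀ δ,
      ‖T u - T v‖ ≤ 1 / 2 * ‖u - v‖ := by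
    intro u hu v hv
    have su := lp_one_summable u
    have sv := lp_one_summable v
    have sd := lp_one_summable (u - v)
    rw [lp.coeFn_sub] at sd
    obtain ⟨a1, a2⟩ := cubic_norm hε hJ hρ sd su su
    obtain ⟨b1, b2⟩ := cubic_norm hε hJ hρ sv sd su
    obtain ⟨c1, c2⟩ := cubic_norm hε hJ hρ sv sv sd
    -- Telescoping: Q(u,u,u) - Q(v,v,v) = Q(u-v,u,u) + Q(v,u-v,u) + Q(v,v,u-v).
    have hdec : ∀ n, ‖(T u - T v : EllOne E) n‖ ≤
        ‖J n (transportCoeff (herglotzCoeff ρ (⇑u - ⇑v) u) u n)‖ +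
        ‖J n (transportCoeff (herglotzCoeff ρ v (⇑u - ⇑v)) u n)‖ +
        ‖J n (transportCoeff (herglotzCoeff ρ v v) (⇑u - ⇑v) n)‖ := by
      intro n
      have : (T u - T v : EllOne E) n = J n (transportCoeff (herglotzCoeff ρ (⇑u - ⇑v) u) u n) +
          J n (transportCoeff (herglotzCoeff ρ v (⇑u - ⇑v)) u n) +
          J n (transportCoeff (herglotzCoeff ρ v v) (⇑u - ⇑v) n) := by
        rw [herglotzCoeff_sub_left hρ su sv su, herglotzCoeff_sub_right hρ sv su sv,
          transportCoeff_sub_left, transportCoeff_sub_left, transportCoeff_sub_right]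
        have hsub : (T u - T v : EllOne E) n = J n (transportCoeff (herglotzCoeff ρ u u) u n) -
            J n (transportCoeff (herglotzCoeff ρ v v) v n) := by
          rw [lp.coeFn_sub]; rfl
        rw [hsub]
        simp only [map_sub]
        abel
      rw [this]
      exact norm_add₃_le
    have hN : ∑' n, ‖((⇑u - ⇑v) n : E)‖ = ‖u - v‖ := by
      rw [lp_one_norm, lp.coeFn_sub]
    rw [lp_one_norm]
    refine ((lp_one_summable (T u - T v)).tsum_le_tsum hdec ((a1.add b1).add c1)).trans ?_
    rw [(a1.add b1).tsum_add c1, a1.tsum_add b1]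
    rw [hN, ← lp_one_norm] at a2 b2 c2
    rw [← lp_one_norm] at b2
    have ru := hR u hu
    have rv := hR v hv
    have hMδ : 0 ≤ M + δ := by linarith
    have hd := norm_nonneg (u - v)
    have e1 : 2 * ε * (‖u - v‖ * ‖u‖ * ‖u‖) ≤ 2 * ε * (‖u - v‖ * (M + δ) * (M + δ)) := by gcongr
    have e2 : 2 * ε * (‖v‖ * ‖u - v‖ * ‖u‖) ≤ 2 * ε * ((M + δ) * ‖u - v‖ * (M + δ)) := by gcongr
    have e3 : 2 * ε * (‖v‖ * ‖v‖ * ‖u - v‖) ≤ 2 * ε * ((M + δ) * (M + δ) * ‖u - v‖) := by gcongr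
    have e4 := mul_le_mul_of_nonneg_right h2 hd
    calc _ ≤ 6 * ε * (M + δ) ^ 2 * ‖u - v‖ := by linarith
      _ ≤ _ := e4
  have hcon : ContractingWith (1 / 2) (hmaps.restrict Φ _ _) := by
    refine ⟨by norm_num, LipschitzWith.of_dist_le_mul ?_⟩
    rintro ⟨u, hu⟩ ⟨v, hv⟩
    simp only [Subtype.dist_eq, MapsTo.val_restrict_apply, dist_eq_norm, Φ, add_sub_add_left_eq_sub]
    simpa using hlip u hu v hv
  obtain ⟨u, hu, hfix, -⟩ := ContractingWith.exists_fixedPoint'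
    (Metric.isClosed_closedBall.isComplete) hmaps hcon (Metric.mem_closedBall_self hδ)
    (edist_ne_top _ _)
  refine ⟨u, lp_one_summable u, ?_, fun n => ?_⟩
  · rw [mem_closedBall_iff_norm, lp_one_norm, lp.coeFn_sub] at hu
    exact hu
  · exact (congrArg (fun w : EllOne E => w n) hfix).symm

end AbstractFixedPoint

/-! ### Solving the coefficient system on shrinking disks. -/

section Coefficients

/-- `g ↦ ∫₀ᵗ exp(-κ(t-τ)) g(τ) dτ` on continuous functions on `[0,b]`. -/
noncomputable def decayIntegral {b : ℝ} (hb : 0 ≤ b) (κ : ℝ) :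
    C(Icc (0 : ℝ) b, ℂ) →+ C(Icc (0 : ℝ) b, ℂ) where
  toFun g :=
    { toFun := fun t => ∫ τ in (0 : ℝ)..t, (Real.exp (-κ * (t - τ)) : ℂ) * IccExtend hb g τ
      continuous_toFun := by
        have hg : Continuous (IccExtend hb g) := g.continuous.Icc_extend'
        have h : Continuous fun t : ℝ =>
            ∫ τ in (0 : ℝ)..t, (Real.exp (-κ * (t - τ)) : ℂ) * IccExtend hb g τ := by
          refine intervalIntegral.continuous_parametric_intervalIntegral_of_continuous ?_
            continuous_id
          refine Continuous.mul ?_ (hg.comp continuous_snd)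
          fun_prop
        exact h.comp continuous_subtype_val }
  map_zero' := by ext t; simp [IccExtend]
  map_add' g h := by
    ext t
    have hg : Continuous (IccExtend hb g) := g.continuous.Icc_extend'
    have hh : Continuous (IccExtend hb h) := h.continuous.Icc_extend'
    have : ∀ τ, IccExtend hb (⇑(g + h)) τ = IccExtend hb g τ + IccExtend hb h τ := fun τ => by
      simp [IccExtend]
    simp only [ContinuousMap.coe_mk, ContinuousMap.add_apply, this, mul_add]
    refine intervalIntegral.integral_add ?_ ?_ <;>
    · refine Continuous.intervalIntegrable ?_ _ _
      fun_prop

theorem norm_IccExtend_le {b : ℝ} (hb : 0 ≤ b) (g : C(Icc (0 : ℝ) b, ℂ)) (τ : ℝ) :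
    ‖IccExtend hb g τ‖ ≤ ‖g‖ := g.norm_coe_le_norm _

theorem norm_decayIntegral_le {b : ℝ} (hb : 0 ≤ b) {κ C : ℝ} (hC : 0 ≤ C)
    (h : ∀ t ∈ Icc 0 b, ∫ τ in (0 : ℝ)..t, Real.exp (-κ * (t - τ)) ≤ C)
    (g : C(Icc (0 : ℝ) b, ℂ)) : ‖decayIntegral hb κ g‖ ≤ C * ‖g‖ := by
  rw [ContinuousMap.norm_le _ (by positivity)]
  rintro ⟨t, ht⟩
  change ‖∫ τ in (0 : ℝ)..t, (Real.exp (-κ * (t - τ)) : ℂ) * IccExtend hb g τ‖ ≤ _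
  have h1 : ‖∫ τ in (0 : ℝ)..t, (Real.exp (-κ * (t - τ)) : ℂ) * IccExtend hb g τ‖ ≤
      ∫ τ in (0 : ℝ)..t, Real.exp (-κ * (t - τ)) * ‖g‖ := by
    refine intervalIntegral.norm_integral_le_of_norm_le ht.1 (.of_forall fun τ _ => ?_)
      (Continuous.intervalIntegrable (by fun_prop) _ _)
    rw [norm_mul, Complex.norm_real, Real.norm_of_nonneg (Real.exp_pos _).le]
    exact mul_le_mul_of_nonneg_left (norm_IccExtend_le hb g τ) (Real.exp_pos _).le
  rw [intervalIntegral.integral_mul_const] at h1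
  exact h1.trans (mul_le_mul_of_nonneg_right (h t ht) (norm_nonneg _))

theorem integral_exp_decay_le_length {b κ t : ℝ} (hκ : 0 ≤ κ) (ht : t ∈ Icc 0 b) :
    ∫ τ in (0 : ℝ)..t, Real.exp (-κ * (t - τ)) ≤ b := by
  have h1 : ∫ τ in (0 : ℝ)..t, Real.exp (-κ * (t - τ)) ≤ ∫ τ in (0 : ℝ)..t, (1 : ℝ) := by
    refine intervalIntegral.integral_mono_on ht.1
      (Continuous.intervalIntegrable (by fun_prop) _ _) (by simp) fun τ hτ => ?_
    rw [Real.exp_le_one_iff]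
    nlinarith [hτ.2]
  simp only [intervalIntegral.integral_const, sub_zero, smul_eq_mul, mul_one] at h1
  exact h1.trans ht.2

theorem integral_exp_decay_le_inv {κ t : ℝ} (hκ : 0 < κ) :
    ∫ τ in (0 : ℝ)..t, Real.exp (-κ * (t - τ)) ≤ 1 / κ := by
  have hd : ∀ τ ∈ uIcc 0 t, HasDerivAt (fun τ => Real.exp (-κ * (t - τ)) / κ)
      (Real.exp (-κ * (t - τ))) τ := by
    intro τ _
    have h1 : HasDerivAt (fun τ => -κ * (t - τ)) κ τ := by
      have := ((hasDerivAt_id τ).const_sub t).const_mul (-κ)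
      simpa using this
    have h2 := h1.exp.div_const κ
    rwa [mul_div_cancel_right₀ _ hκ.ne'] at h2
  rw [intervalIntegral.integral_eq_sub_of_hasDerivAt hd
    (Continuous.intervalIntegrable (by fun_prop) _ _)]
  simp only [sub_self, mul_zero, Real.exp_zero]
  have := div_nonneg (Real.exp_pos (-κ * (t - 0))).le hκ.le
  linarith

/-- The kernel has integral at most b, and at most 1/(Ln) when n > 0. The first estimate covers the
summand 1, which includes the undamped mode n = 0; the second covers the summand n. -/
theorem decayIntegral_bound {b L : ℝ} (hb : 0 ≤ b) (hL : 0 < L) (n : ℕ)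
    (g : C(Icc (0 : ℝ) b, ℂ)) :
    (n + 1) * ‖decayIntegral hb (L * n) g‖ ≤ (b + 1 / L) * ‖g‖ := by
  have hn : (0 : ℝ) ≤ n := n.cast_nonneg
  have h1 := norm_decayIntegral_le hb hb
    (fun t ht => integral_exp_decay_le_length (mul_nonneg hL.le hn) ht) g
  have h2 : n * ‖decayIntegral hb (L * n) g‖ ≤ 1 / L * ‖g‖ := by
    rcases n.eq_zero_or_pos with rfl | hpos
    · simp only [Nat.cast_zero, zero_mul]; positivity
    · have hn' : (0 : ℝ) < n := by exact_mod_cast hpos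
      have h3 := norm_decayIntegral_le hb (κ := L * n) (by positivity)
        (fun t _ => integral_exp_decay_le_inv (mul_pos hL hn')) g
      calc n * ‖decayIntegral hb (L * n) g‖ ≤ n * (1 / (L * n) * ‖g‖) := by gcongr
        _ = 1 / L * ‖g‖ := by field_simp
  linarith

theorem herglotzCoeff_apply {b : ℝ} {ρ u v : ℕ → C(Icc (0 : ℝ) b, ℂ)} (hρ : ∀ m, ‖ρ m‖ ≤ 1)
    (hu : Summable fun n => ‖u n‖) (hv : Summable fun n => ‖v n‖) (j : ℕ) (t : Icc (0 : ℝ) b) :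
    herglotzCoeff ρ u v j t =
      herglotzCoeff (fun n => ρ n t) (fun n => u n t) (fun n => v n t) j := by
  simp only [herglotzCoeff, ContinuousMap.smul_apply]
  rw [← ContinuousMap.tsum_apply (summable_herglotz_aux hρ hu hv j)]
  rfl

theorem transportCoeff_apply {b : ℝ} (h u : ℕ → C(Icc (0 : ℝ) b, ℂ)) (n : ℕ)
    (t : Icc (0 : ℝ) b) :
    transportCoeff h u n t = transportCoeff (fun n => h n t) (fun n => u n t) n := by
  simp only [transportCoeff, ContinuousMap.sum_apply, ContinuousMap.smul_apply,
    ContinuousMap.mul_apply]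

/-- The product of the rescaled coefficients of index j + m and m carries s^(j+2m); the weight
removes the surplus s^(2m). -/
theorem herglotzCoeff_scale {s : ℝ} (hs : s ≠ 0) (p : ℕ → ℂ) (j : ℕ) :
    herglotzCoeff (fun m => ((s : ℂ) ^ (2 * m))⁻¹) (fun n => p n * (s : ℂ) ^ n)
      (fun n => p n * (s : ℂ) ^ n) j = herglotzCoeff 1 p p j * (s : ℂ) ^ j := by
  have hs' : (s : ℂ) ≠ 0 := by exact_mod_cast hs
  simp only [herglotzCoeff, smul_eq_mul, mul_assoc, ← tsum_mul_right, Pi.one_apply]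
  congr 2
  ext m
  have : star ((s : ℂ) ^ m) = (s : ℂ) ^ m := by simp
  rw [star_mul, this, pow_add, two_mul, pow_add]
  field_simp

theorem transportCoeff_scale (s : ℂ) (h p : ℕ → ℂ) (n : ℕ) :
    transportCoeff (fun n => h n * s ^ n) (fun n => p n * s ^ n) n =
      transportCoeff h p n * s ^ n := by
  simp only [transportCoeff, Finset.sum_mul, smul_eq_mul]
  refine Finset.sum_congr rfl fun x hx => ?_
  have hx' : x.1 + x.2 = n := by simpa using hx
  rw [← hx', pow_add]
  ring

/-- The unknowns are u_n = p_n s(t)^n with s(t) = s₀ exp(-Lt); the fixed-point equation is the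
Duhamel form of u_n' = -L n u_n + (cubic term). Hypothesis `hs` keeps s(t) ≥ s₁ up to time b, so
bounds on u become bounds on p at radius s₁. -/
theorem exists_coeff_solution_aux {a : ℕ → ℂ} {s₀ s₁ b L δ : ℝ} (hs₁ : 1 ≤ s₁) (hb : 0 ≤ b)
    (hL : 0 < L) (hs : s₁ ≤ s₀ * Real.exp (-(L * b)))
    (ha : Summable fun n => ‖a n‖ * s₀ ^ n) (hδ : 0 ≤ δ)
    (h1 : 2 * (b + 1 / L) * ((∑' n, ‖a n‖ * s₀ ^ n) + δ) ^ 3 ≤ δ)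
    (h2 : 6 * (b + 1 / L) * ((∑' n, ‖a n‖ * s₀ ^ n) + δ) ^ 2 ≤ 1 / 2) :
    ∃ p : ℕ → ℝ → ℂ, (∀ n, Continuous (p n)) ∧
      (∃ κ : ℕ → ℝ, Summable κ ∧ ∀ n t, ‖p n t‖ * s₁ ^ n ≤ κ n) ∧
      (∃ d : ℕ → ℝ, Summable d ∧ ∑' n, d n ≤ δ ∧ ∀ n t, ‖p n t - a n‖ * s₁ ^ n ≤ d n) ∧
      ∀ n, ∀ t ∈ Icc 0 b, p n t = a n + ∫ τ in (0 : ℝ)..t,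
        transportCoeff (herglotzCoeff 1 (fun k => p k τ) (fun k => p k τ)) (fun k => p k τ) n := by
  have hs₀ : 0 < s₀ := by
    by_contra h
    have := mul_nonpos_of_nonpos_of_nonneg (not_lt.1 h) (Real.exp_pos (-(L * b))).le
    linarith
  set s : ℝ → ℝ := fun t => s₀ * Real.exp (-(L * t)) with hsdef
  have hsc : Continuous s := by fun_prop
  have hspos : ∀ t, 0 < s t := fun t => mul_pos hs₀ (Real.exp_pos _)
  have hs1 : ∀ t ∈ Icc 0 b, s₁ ≤ s t := by
    intro t ht
    refine hs.trans (mul_le_mul_of_nonneg_left (Real.exp_le_exp.2 ?_) hs₀.le)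
    nlinarith [ht.2]
  have hs0 : ∀ t ∈ Icc 0 b, s t ≤ s₀ := by
    intro t ht
    refine mul_le_of_le_one_right hs₀.le (Real.exp_le_one_iff.2 ?_)
    nlinarith [ht.1]
  -- The weights have norm at most 1 precisely because s(t) ≥ s₁ ≥ 1.
  let ρ : ℕ → C(Icc (0 : ℝ) b, ℂ) := fun m =>
    ⟨fun t => ((s t : ℂ) ^ (2 * m))⁻¹, by
      refine Continuous.inv₀ (by fun_prop) fun t => ?_
      exact pow_ne_zero _ (by exact_mod_cast (hspos t).ne')⟩
  have hρ : ∀ m, ‖ρ m‖ ≤ 1 := by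
    intro m
    rw [ContinuousMap.norm_le _ zero_le_one]
    rintro ⟨t, ht⟩
    change ‖((s t : ℂ) ^ (2 * m))⁻¹‖ ≤ 1
    rw [norm_inv, norm_pow, Complex.norm_real, Real.norm_of_nonneg (hspos t).le]
    exact inv_le_one_of_one_le₀ (one_le_pow₀ (hs₁.trans (hs1 t ht)))
  let u₀ : ℕ → C(Icc (0 : ℝ) b, ℂ) := fun n =>
    ⟨fun t => a n * (s t : ℂ) ^ n, by fun_prop⟩
  have hu₀n : ∀ n, ‖u₀ n‖ ≤ ‖a n‖ * s₀ ^ n := by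
    intro n
    rw [ContinuousMap.norm_le _ (by positivity)]
    rintro ⟨t, ht⟩
    change ‖a n * (s t : ℂ) ^ n‖ ≤ _
    rw [norm_mul, norm_pow, Complex.norm_real, Real.norm_of_nonneg (hspos t).le]
    have := hs0 t ht
    have := (hspos t).le
    gcongr
  have hu₀ : Summable fun n => ‖u₀ n‖ := ha.of_nonneg_of_le (fun _ => norm_nonneg _) hu₀n
  obtain ⟨u, hu, hud, hfix⟩ := exists_cubic_fixedPoint (J := fun n => decayIntegral hb (L * n))
    (ε := b + 1 / L) (by positivity) (fun n g => decayIntegral_bound hb hL n g) hρ hu₀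
    (hu₀.tsum_le_tsum hu₀n ha) hδ h1 h2
  -- Freezing time outside [0, b] makes the coefficients continuous and uniformly bounded on all of
  -- ℝ.
  set P : ℝ → Icc (0 : ℝ) b := projIcc 0 b hb with hP
  have hPc : Continuous P := continuous_projIcc
  set p : ℕ → ℝ → ℂ := fun n t => u n (P t) / (s (P t) : ℂ) ^ n with hp
  have hsne : ∀ t, (s t : ℂ) ≠ 0 := fun t => by exact_mod_cast (hspos t).ne'
  have hpu : ∀ n t, p n t * (s (P t) : ℂ) ^ n = u n (P t) := fun n t =>
    div_mul_cancel₀ _ (pow_ne_zero _ (hsne _))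
  have hnorm : ∀ (z : ℂ) n t, ‖z‖ * s₁ ^ n ≤ ‖z * (s (P t) : ℂ) ^ n‖ := by
    intro z n t
    rw [norm_mul, norm_pow, Complex.norm_real, Real.norm_of_nonneg (hspos _).le]
    have := hs1 (P t) (P t).2
    gcongr
  refine ⟨p, ?_, ⟨fun n => ‖u n‖, hu, ?_⟩, ⟨fun n => ‖u n - u₀ n‖, ?_, hud, ?_⟩, ?_⟩
  · intro n
    refine Continuous.div ((u n).continuous.comp hPc) ?_ fun t => pow_ne_zero _ (hsne _)
    fun_prop
  · intro n t
    refine (hnorm _ n t).trans ?_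
    rw [hpu]
    exact (u n).norm_coe_le_norm _
  · exact (hu.add hu₀).of_nonneg_of_le (fun _ => norm_nonneg _) fun n => norm_sub_le _ _
  · intro n t
    refine (hnorm _ n t).trans ?_
    rw [sub_mul, hpu]
    exact (u n - u₀ n).norm_coe_le_norm (P t)
  · intro n t ht
    have hPt : P t = ⟨t, ht⟩ := projIcc_of_mem hb ht
    let v : C(Icc (0 : ℝ) b, ℂ) := transportCoeff (herglotzCoeff ρ u u) u n
    have e1 : u n ⟨t, ht⟩ = a n * (s t : ℂ) ^ n + ∫ τ in (0 : ℝ)..t,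
        (Real.exp (-(L * n) * (t - τ)) : ℂ) *
          IccExtend hb v τ :=
      congrArg (fun w : C(Icc (0 : ℝ) b, ℂ) => w ⟨t, ht⟩) (hfix n)
    have e2 : ∀ τ, IccExtend hb v τ =
        transportCoeff (herglotzCoeff 1 (fun k => p k τ) (fun k => p k τ)) (fun k => p k τ) n *
          (s (P τ) : ℂ) ^ n := by
      intro τ
      change transportCoeff (herglotzCoeff ρ u u) u n (P τ) = _
      rw [transportCoeff_apply, ← transportCoeff_scale]
      simp only [herglotzCoeff_apply hρ hu hu, hpu]
      congr 1
      ext j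
      rw [← herglotzCoeff_scale (hspos _).ne']
      simp only [hpu]
      rfl
    have e3 : ∫ τ in (0 : ℝ)..t, (Real.exp (-(L * n) * (t - τ)) : ℂ) *
          IccExtend hb v τ =
        (∫ τ in (0 : ℝ)..t, transportCoeff (herglotzCoeff 1 (fun k => p k τ) (fun k => p k τ))
          (fun k => p k τ) n) * (s t : ℂ) ^ n := by
      rw [← intervalIntegral.integral_mul_const]
      refine intervalIntegral.integral_congr fun τ hτ => ?_
      rw [uIcc_of_le ht.1] at hτ
      have hPτ : (P τ : ℝ) = τ := by
        rw [hP, projIcc_of_mem hb ⟨hτ.1, hτ.2.trans ht.2⟩]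
      -- The decay kernel transports the weight s(τ)^n exactly to s(t)^n, so undoing the rescaling
      -- leaves a plain integral.
      have e4 : (Real.exp (-(L * n) * (t - τ)) : ℂ) * (s τ : ℂ) ^ n = (s t : ℂ) ^ n := by
        have : Real.exp (-(L * n) * (t - τ)) * s τ ^ n = s t ^ n := by
          simp only [hsdef, mul_pow, ← Real.exp_nat_mul]
          rw [mul_left_comm, ← Real.exp_add]
          congr 2
          ring
        exact_mod_cast this
      simp only [e2, hPτ]
      rw [← e4]
      ring
    have e5 : p n t * (s t : ℂ) ^ n = u n ⟨t, ht⟩ := by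
      have := hpu n t
      rwa [hPt] at this
    refine mul_right_cancel₀ (pow_ne_zero n (hsne t)) ?_
    rw [e5, e1, e3]
    ring

theorem exists_coeff_solution {a : ℕ → ℂ} {s₀ s₁ δ : ℝ} (hs₁ : 1 ≤ s₁) (hs : s₁ < s₀)
    (ha : Summable fun n => ‖a n‖ * s₀ ^ n) (hδ : 0 < δ) :
    ∃ b > 0, ∃ p : ℕ → ℝ → ℂ, (∀ n, Continuous (p n)) ∧
      (∃ κ : ℕ → ℝ, Summable κ ∧ ∀ n t, ‖p n t‖ * s₁ ^ n ≤ κ n) ∧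
      (∃ d : ℕ → ℝ, Summable d ∧ ∑' n, d n ≤ δ ∧ ∀ n t, ‖p n t - a n‖ * s₁ ^ n ≤ d n) ∧
      ∀ n, ∀ t ∈ Icc 0 b, p n t = a n + ∫ τ in (0 : ℝ)..t,
        transportCoeff (herglotzCoeff 1 (fun k => p k τ) (fun k => p k τ)) (fun k => p k τ) n := by
  set R := (∑' n, ‖a n‖ * s₀ ^ n) + δ with hR
  have hs₀ : 0 < s₀ := by linarith
  have hR0 : 0 < R := add_pos_of_nonneg_of_pos (tsum_nonneg fun n => by positivity) hδ
  -- The two terms of ε are the two smallness conditions of the fixed-point theorem. With L = 2/ε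
  -- and b ≤ ε/2 one gets b + 1/L ≤ ε, and b ≤ log(s₀/s₁)/L keeps the radius above s₁.
  set ε := min (δ / (2 * R ^ 3)) (1 / (12 * R ^ 2)) with hε
  have hε0 : 0 < ε := by positivity
  set L := 2 / ε with hL
  have hL0 : 0 < L := by positivity
  have hlog : 0 < Real.log (s₀ / s₁) := Real.log_pos (by rw [one_lt_div (by linarith)]; exact hs)
  set b := min (ε / 2) (Real.log (s₀ / s₁) / L) with hb
  have hb0 : 0 < b := by positivity
  have hbL : b + 1 / L ≤ ε := by
    have h1 : b ≤ ε / 2 := min_le_left _ _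
    have h2 : 1 / L = ε / 2 := by rw [hL]; field_simp
    linarith
  refine ⟨b, hb0, exists_coeff_solution_aux hs₁ hb0.le hL0 ?_ ha hδ.le ?_ ?_⟩
  · have h1 : L * b ≤ Real.log (s₀ / s₁) := by
      have : b ≤ Real.log (s₀ / s₁) / L := min_le_right _ _
      rwa [le_div_iff₀' hL0] at this
    have h2 : Real.exp (-Real.log (s₀ / s₁)) ≤ Real.exp (-(L * b)) :=
      Real.exp_le_exp.2 (neg_le_neg h1)
    rw [Real.exp_neg, Real.exp_log (by positivity), inv_div] at h2
    have h3 := mul_le_mul_of_nonneg_left h2 hs₀.le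
    rwa [mul_div_cancel₀ _ hs₀.ne'] at h3
  · have h1 : ε ≤ δ / (2 * R ^ 3) := min_le_left _ _
    rw [le_div_iff₀ (by positivity)] at h1
    have h2 : (b + 1 / L) * (2 * R ^ 3) ≤ ε * (2 * R ^ 3) := by gcongr
    linarith
  · have h1 : ε ≤ 1 / (12 * R ^ 2) := min_le_right _ _
    rw [le_div_iff₀ (by positivity)] at h1
    have h2 : (b + 1 / L) * (12 * R ^ 2) ≤ ε * (12 * R ^ 2) := by gcongr
    linarith

end Coefficients

/-! ### The boundary identity Re h = |p|². -/

/-- Expand |Σ a_n|² over pairs (n, m). Those with n ≥ m, parametrized by `f₁`, sum to Σ A_j; those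
with n < m, parametrized by `f₂`, sum to the conjugate of Σ A_{j+1}. Taking real parts doubles every
A_j with j > 0. -/
theorem re_tsum_herglotzCoeff {a : ℕ → ℂ} (ha : Summable fun n => ‖a n‖) :
    (∑' j, herglotzCoeff 1 a a j).re = ‖∑' n, a n‖ ^ 2 := by
  have hF : Summable (fun x : ℕ × ℕ => a x.1 * star (a x.2)) :=
    summable_mul_of_summable_norm (f := a) (g := fun n => star (a n)) ha (by simpa using ha)
  let f₁ : ℕ × ℕ → ℕ × ℕ := fun x => (x.1 + x.2, x.2)
  let f₂ : ℕ × ℕ → ℕ × ℕ := fun x => (x.2, x.1 + 1 + x.2)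
  have hf₁ : Function.Injective f₁ := by
    rintro ⟨i, j⟩ ⟨k, l⟩ h
    simp only [f₁, Prod.mk.injEq] at h ⊢
    omega
  have hf₂ : Function.Injective f₂ := by
    rintro ⟨i, j⟩ ⟨k, l⟩ h
    simp only [f₂, Prod.mk.injEq] at h ⊢
    omega
  have hcompl : (range f₁)ᶜ = range f₂ := by
    ext ⟨n, m⟩
    simp only [mem_compl_iff, mem_range, Prod.exists, f₁, f₂, Prod.mk.injEq, not_exists, not_and]
    constructor
    · intro h
      refine ⟨m - n - 1, n, rfl, ?_⟩
      by_contra hne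
      exact h (n - m) m (by omega) rfl
    · rintro ⟨i, j, rfl, rfl⟩ k l h1 h2
      omega
  have hs₁ : Summable fun x : ℕ × ℕ => a (x.1 + x.2) * star (a x.2) := by
    have h := hF.comp_injective hf₁
    simpa only [Function.comp_def] using h
  have hs₂ : Summable fun x : ℕ × ℕ => a x.2 * star (a (x.1 + 1 + x.2)) := by
    have h := hF.comp_injective hf₂
    simpa only [Function.comp_def] using h
  set A : ℕ → ℂ := fun j => ∑' m, a (j + m) * star (a m) with hA
  have hAs : Summable A := hs₁.prod
  have hAs' : Summable fun j => A (j + 1) := (summable_nat_add_iff 1).2 hAs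
  have e1 : (∑' n, a n) * star (∑' n, a n) = ∑' x : ℕ × ℕ, a x.1 * star (a x.2) := by
    rw [tsum_star]
    exact tsum_mul_tsum_of_summable_norm (f := a) (g := fun n => star (a n)) ha
      (by simpa using ha)
  have e2 : ∑' x : ℕ × ℕ, a x.1 * star (a x.2) = ∑' j, A j + ∑' j, star (A (j + 1)) := by
    rw [← Summable.tsum_add_tsum_compl (s := range f₁) (hF.subtype _) (hF.subtype _), hcompl,
      tsum_range (f := fun x : ℕ × ℕ => a x.1 * star (a x.2)) hf₁,
      tsum_range (f := fun x : ℕ × ℕ => a x.1 * star (a x.2)) hf₂]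
    congr 1
    · exact hs₁.tsum_prod
    · refine hs₂.tsum_prod.trans (tsum_congr fun j => ?_)
      rw [hA, tsum_star]
      refine tsum_congr fun m => ?_
      rw [star_mul, star_star]
  have e3 : ∑' j, herglotzCoeff 1 a a j = A 0 + 2 * ∑' j, A (j + 1) := by
    have h : ∀ j, herglotzCoeff 1 a a j = (if j = 0 then 1 else 2) * A j := fun j => by
      simp [herglotzCoeff, hA]
    have hsum : Summable fun j => herglotzCoeff 1 a a j := by
      rw [← summable_nat_add_iff 1]
      simpa [h] using hAs'.mul_left 2
    rw [hsum.tsum_eq_zero_add]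
    simp [h, tsum_mul_left]
  have e4 : (((‖∑' n, a n‖ ^ 2 : ℝ)) : ℂ) = ∑' j, A j + star (∑' j, A (j + 1)) := by
    rw [tsum_star, ← e2, ← e1]
    exact_mod_cast (Complex.mul_conj' _).symm
  rw [hAs.tsum_eq_zero_add] at e4
  have e5 := congrArg Complex.re e4
  rw [Complex.ofReal_re] at e5
  rw [e5, e3]
  simp
  ring

/-- On the unit circle z^m conj(z^m) = 1, so z^j may be written as z^(j+m) conj(z^m). -/
theorem herglotzCoeff_mul_pow {p : ℕ → ℂ} {z : ℂ} (hz : ‖z‖ = 1) (j : ℕ) :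
    herglotzCoeff 1 p p j * z ^ j =
      herglotzCoeff 1 (fun n => p n * z ^ n) (fun n => p n * z ^ n) j := by
  simp only [herglotzCoeff, smul_eq_mul, mul_assoc, ← tsum_mul_right, Pi.one_apply]
  congr 2
  ext m
  have h : z ^ m * star (z ^ m) = 1 := by
    have := Complex.mul_conj' (z ^ m)
    rw [norm_pow, hz] at this
    simpa using this
  rw [star_mul, pow_add]
  linear_combination (-(p (j + m) * star (p m) * z ^ j)) * h

theorem re_tsum_herglotzCoeff_mul_pow {p : ℕ → ℂ} {z : ℂ} (hz : ‖z‖ = 1)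
    (hp : Summable fun n => ‖p n‖) :
    (∑' j, herglotzCoeff 1 p p j * z ^ j).re = ‖∑' n, p n * z ^ n‖ ^ 2 := by
  rw [tsum_congr (herglotzCoeff_mul_pow hz)]
  exact re_tsum_herglotzCoeff (by simpa [hz] using hp)

theorem im_herglotzCoeff_zero (p : ℕ → ℂ) (hp : Summable fun n => ‖p n‖) :
    (herglotzCoeff 1 p p 0).im = 0 := by
  have h : Summable fun m => p m * star (p m) := by
    have := summable_herglotz_aux (ρ := fun _ => (1 : ℂ)) (by simp) hp hp 0
    simpa using this
  simp only [herglotzCoeff, if_true, one_smul, zero_add, Pi.one_apply, mul_one]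
  rw [Complex.im_tsum h]
  have : ∀ m, (p m * star (p m)).im = 0 := fun m => by
    simpa using congrArg Complex.im (Complex.mul_conj (p m))
  rw [tsum_congr this, tsum_zero]

/-! ### Power series with time-dependent coefficients. -/

section Series

/-- The power series with time-dependent coefficients `c`. -/
noncomputable def powerSum (c : ℕ → ℝ → ℂ) (t : ℝ) (z : ℂ) : ℂ := ∑' n, c n t * z ^ n

/-- A smaller radius pays for a derivative: for θ = s₂/s₁ < 1, (n+1)θ^n is at most the geometric sum
Σ_{k≤n} θ^k. -/
theorem exists_succ_mul_pow_le {s₁ s₂ : ℝ} (h0 : 0 < s₂) (h : s₂ < s₁) :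
    ∃ C, 0 ≤ C ∧ ∀ n : ℕ, (n + 1) * s₂ ^ n ≤ C * s₁ ^ n := by
  have hs₁ : 0 < s₁ := h0.trans h
  have hθ : s₂ / s₁ < 1 := (div_lt_one hs₁).2 h
  have hθ0 : 0 < s₂ / s₁ := div_pos h0 hs₁
  refine ⟨(1 - s₂ / s₁)⁻¹, inv_nonneg.2 (by linarith), fun n => ?_⟩
  have h1 : (n + 1) * (s₂ / s₁) ^ n ≤ (1 - s₂ / s₁)⁻¹ := by
    calc (n + 1) * (s₂ / s₁) ^ n = ∑ _k ∈ Finset.range (n + 1), (s₂ / s₁) ^ n := by simp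
      _ ≤ ∑ k ∈ Finset.range (n + 1), (s₂ / s₁) ^ k := Finset.sum_le_sum fun k hk =>
          pow_le_pow_of_le_one hθ0.le hθ.le (Nat.lt_succ_iff.1 (Finset.mem_range.1 hk))
      _ ≤ ∑' k, (s₂ / s₁) ^ k := Summable.sum_le_tsum _ (fun _ _ => by positivity)
          (summable_geometric_of_lt_one hθ0.le hθ)
      _ = _ := tsum_geometric_of_lt_one hθ0.le hθ
  rw [div_pow, mul_div_assoc', div_le_iff₀ (by positivity)] at h1
  exact h1

variable {c : ℕ → ℝ → ℂ} {κ : ℕ → ℝ} {s : ℝ}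

theorem norm_mul_pow_le (hb : ∀ n t, ‖c n t‖ * s ^ n ≤ κ n) {z : ℂ} (hz : ‖z‖ ≤ s) (n : ℕ)
    (t : ℝ) : ‖c n t * z ^ n‖ ≤ κ n := by
  refine le_trans ?_ (hb n t)
  rw [norm_mul, norm_pow]
  gcongr

theorem continuousOn_powerSum (hc : ∀ n, Continuous (c n)) (hκ : Summable κ)
    (hb : ∀ n t, ‖c n t‖ * s ^ n ≤ κ n) :
    ContinuousOn (Function.uncurry (powerSum c)) (univ ×ˢ Metric.closedBall 0 s) := by
  refine continuousOn_tsum (u := κ) (f := fun n (q : ℝ × ℂ) => c n q.1 * q.2 ^ n) ?_ hκ ?_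
  · intro n
    have := hc n
    exact Continuous.continuousOn (by fun_prop)
  · rintro n ⟨t, z⟩ ⟨-, hz⟩
    exact norm_mul_pow_le hb (by simpa using hz) n t

theorem hasDerivAt_powerSum (hκ : Summable κ) (hb : ∀ n t, ‖c n t‖ * s ^ n ≤ κ n) (t : ℝ) {z : ℂ}
    (hz : z ∈ Metric.ball (0 : ℂ) s) :
    HasDerivAt (powerSum c t) (deriv (powerSum c t) z) z ∧
      HasSum (fun n => n * (c n t * z ^ n)) (z * deriv (powerSum c t) z) := by
  have h1 : ∀ i : ℕ, DifferentiableOn ℂ (fun w : ℂ => c i t * w ^ i) (Metric.ball 0 s) := by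
    intro i; fun_prop
  have h2 : ∀ (i : ℕ) (w : ℂ), w ∈ Metric.ball (0 : ℂ) s → ‖c i t * w ^ i‖ ≤ κ i :=
    fun i w hw => norm_mul_pow_le hb (by simpa using (Metric.mem_ball.1 hw).le) i t
  constructor
  · exact ((Complex.differentiableOn_tsum_of_summable_norm hκ h1 Metric.isOpen_ball
      h2).differentiableAt (Metric.isOpen_ball.mem_nhds hz)).hasDerivAt
  · have := (Complex.hasSum_deriv_of_summable_norm hκ h1 Metric.isOpen_ball h2 hz).mul_left z
    have e : (fun n : ℕ => n * (c n t * z ^ n)) =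
        fun i => z * deriv (fun w : ℂ => c i t * w ^ i) z := by
      funext n
      rcases n with _ | n
      · simp
      · simp only [deriv_const_mul_field', deriv_pow_field, Nat.add_sub_cancel]
        ring
    rw [e]
    exact this

theorem tsum_transportCoeff_mul_pow {h p : ℕ → ℂ} {z : ℂ}
    (hh : Summable fun n : ℕ => ‖h n * z ^ n‖) (hp : Summable fun n : ℕ => ‖p n * z ^ n‖)
    (hh' : Summable fun n : ℕ => ‖n * (h n * z ^ n)‖)
    (hp' : Summable fun n : ℕ => ‖n * (p n * z ^ n)‖) :
    ∑' n, transportCoeff h p n * z ^ n =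
      (∑' n, h n * z ^ n) * (∑' n : ℕ, n * (p n * z ^ n)) -
      (∑' n : ℕ, n * (h n * z ^ n)) * (∑' n, p n * z ^ n) -
      (∑' n, h n * z ^ n) * (∑' n, p n * z ^ n) := by
  rw [tsum_mul_tsum_eq_tsum_sum_antidiagonal_of_summable_norm hh hp',
    tsum_mul_tsum_eq_tsum_sum_antidiagonal_of_summable_norm hh' hp,
    tsum_mul_tsum_eq_tsum_sum_antidiagonal_of_summable_norm hh hp]
  have s1 := (summable_norm_sum_mul_antidiagonal_of_summable_norm hh hp').of_norm
  have s2 := (summable_norm_sum_mul_antidiagonal_of_summable_norm hh' hp).of_norm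
  have s3 := (summable_norm_sum_mul_antidiagonal_of_summable_norm hh hp).of_norm
  rw [← s1.tsum_sub s2, ← (s1.sub s2).tsum_sub s3]
  refine tsum_congr fun n => ?_
  rw [transportCoeff, Finset.sum_mul, ← Finset.sum_sub_distrib, ← Finset.sum_sub_distrib]
  refine Finset.sum_congr rfl fun x hx => ?_
  have hx' : x.1 + x.2 = n := by simpa using hx
  rw [← hx', pow_add, smul_eq_mul]
  ring

theorem continuous_herglotzCoeff {p : ℕ → ℝ → ℂ} (hs : 1 ≤ s) (hp : ∀ n, Continuous (p n))
    (hκ : Summable κ) (hb : ∀ n t, ‖p n t‖ * s ^ n ≤ κ n) :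
    (∀ n, Continuous fun t => herglotzCoeff 1 (fun k => p k t) (fun k => p k t) n) ∧
      ∃ η : ℕ → ℝ, Summable η ∧ (∀ n, 0 ≤ η n) ∧
        ∀ n t, ‖herglotzCoeff 1 (fun k => p k t) (fun k => p k t) n‖ * s ^ n ≤ η n := by
  have hκ0 : ∀ n, 0 ≤ κ n := fun n => (by positivity : 0 ≤ ‖p n 0‖ * s ^ n).trans (hb n 0)
  have hs2 := (summable_shift_mul hκ hκ hκ0 hκ0).1
  have hp1 : ∀ n t, ‖p n t‖ ≤ κ n := fun n t =>
    (le_mul_of_one_le_right (norm_nonneg _) (one_le_pow₀ hs)).trans (hb n t)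
  have hterm : ∀ j m t, ‖p (j + m) t * star (p m t)‖ * s ^ j ≤ κ (j + m) * κ m := by
    intro j m t
    rw [norm_mul, norm_star, mul_right_comm]
    refine mul_le_mul ?_ (hp1 m t) (norm_nonneg _) (hκ0 _)
    refine le_trans ?_ (hb (j + m) t)
    exact mul_le_mul_of_nonneg_left (pow_le_pow_right₀ hs (Nat.le_add_right _ _)) (norm_nonneg _)
  have hterm' : ∀ j m t, ‖p (j + m) t * star (p m t)‖ ≤ κ (j + m) * κ m := fun j m t =>
    (le_mul_of_one_le_right (norm_nonneg _) (one_le_pow₀ hs)).trans (hterm j m t)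
  refine ⟨fun n => ?_, fun j => 2 * ∑' m, κ (j + m) * κ m, hs2.prod.mul_left 2,
    fun j => mul_nonneg zero_le_two (tsum_nonneg fun m => mul_nonneg (hκ0 _) (hκ0 _)), ?_⟩
  · simp only [herglotzCoeff, Pi.one_apply, mul_one, smul_eq_mul]
    refine continuous_const.mul ?_
    refine continuous_tsum (fun m => ?_) (hs2.prod_factor n) (fun m t => hterm' n m t)
    exact (hp _).mul (hp _).star
  · intro j t
    simp only [herglotzCoeff, Pi.one_apply, mul_one]
    rw [norm_smul, mul_assoc]
    refine mul_le_mul (by split_ifs <;> norm_num) ?_ (by positivity) zero_le_two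
    have hs0 : (0 : ℝ) < s ^ j := by positivity
    rw [← le_div_iff₀ hs0, ← tsum_div_const]
    exact tsum_of_norm_bounded ((hs2.prod_factor j).div_const _).hasSum fun m => by
      rw [le_div_iff₀ hs0]; exact hterm j m t

theorem continuous_transportCoeff {h p : ℕ → ℝ → ℂ} {η : ℕ → ℝ} {s₂ : ℝ} (hs₂ : 0 < s₂)
    (hs : s₂ < s) (hh : ∀ n, Continuous (h n)) (hp : ∀ n, Continuous (p n))
    (hη : Summable η) (hη0 : ∀ n, 0 ≤ η n) (hκ : Summable κ)
    (hhb : ∀ n t, ‖h n t‖ * s ^ n ≤ η n) (hpb : ∀ n t, ‖p n t‖ * s ^ n ≤ κ n) :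
    (∀ n, Continuous fun t => transportCoeff (fun k => h k t) (fun k => p k t) n) ∧
      ∃ γ : ℕ → ℝ, Summable γ ∧
        ∀ n t, ‖transportCoeff (fun k => h k t) (fun k => p k t) n‖ * s₂ ^ n ≤ γ n := by
  have hs0 : 0 < s := hs₂.trans hs
  have hκ0 : ∀ n, 0 ≤ κ n := fun n => (by positivity : 0 ≤ ‖p n 0‖ * s ^ n).trans (hpb n 0)
  obtain ⟨C, hC, hCb⟩ := exists_succ_mul_pow_le hs₂ hs
  have hm : Summable (fun x : ℕ × ℕ => η x.1 * κ x.2) := hη.mul_of_nonneg hκ hη0 hκ0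
  refine ⟨fun n => ?_, fun n => C * ∑ x ∈ Finset.HasAntidiagonal.antidiagonal n, η x.1 * κ x.2,
    (summable_sum_mul_antidiagonal_of_summable_mul (f := η) (g := κ) hm).mul_left C, ?_⟩
  · simp only [transportCoeff, smul_eq_mul]
    exact continuous_finsetSum _ fun x _ => continuous_const.mul ((hh _).mul (hp _))
  · intro n t
    have h1 := norm_transportCoeff_le (fun k => h k t) (fun k => p k t) n
    have h2 : (∑ x ∈ Finset.HasAntidiagonal.antidiagonal n, ‖h x.1 t‖ * ‖p x.2 t‖) * s ^ n ≤
        ∑ x ∈ Finset.HasAntidiagonal.antidiagonal n, η x.1 * κ x.2 := by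
      rw [Finset.sum_mul]
      refine Finset.sum_le_sum fun x hx => ?_
      have hx' : x.1 + x.2 = n := by simpa using hx
      rw [← hx', pow_add]
      calc ‖h x.1 t‖ * ‖p x.2 t‖ * (s ^ x.1 * s ^ x.2)
          = (‖h x.1 t‖ * s ^ x.1) * (‖p x.2 t‖ * s ^ x.2) := by ring
        _ ≤ _ := mul_le_mul (hhb _ _) (hpb _ _) (by positivity) (hη0 _)
    have h3 : 0 ≤ ∑ x ∈ Finset.HasAntidiagonal.antidiagonal n, ‖h x.1 t‖ * ‖p x.2 t‖ :=
      Finset.sum_nonneg fun _ _ => by positivity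
    calc _ ≤ ((n + 1) * ∑ x ∈ Finset.HasAntidiagonal.antidiagonal n, ‖h x.1 t‖ * ‖p x.2 t‖) *
          s₂ ^ n := by gcongr
      _ = ((n + 1) * s₂ ^ n) *
          ∑ x ∈ Finset.HasAntidiagonal.antidiagonal n, ‖h x.1 t‖ * ‖p x.2 t‖ := by ring
      _ ≤ (C * s ^ n) *
          ∑ x ∈ Finset.HasAntidiagonal.antidiagonal n, ‖h x.1 t‖ * ‖p x.2 t‖ := by
            exact mul_le_mul_of_nonneg_right (hCb n) h3
      _ = C * ((∑ x ∈ Finset.HasAntidiagonal.antidiagonal n, ‖h x.1 t‖ * ‖p x.2 t‖) *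
          s ^ n) := by ring
      _ ≤ _ := mul_le_mul_of_nonneg_left h2 hC

theorem exists_summable_taylor {g : ℂ → ℂ} {r s₀ : ℝ} (hg : DifferentiableOn ℂ g (Metric.ball 0 r))
    (h0 : 0 ≤ s₀) (hs : s₀ < r) :
    ∃ a : ℕ → ℂ, (Summable fun n => ‖a n‖ * s₀ ^ n) ∧
      ∀ z ∈ Metric.ball (0 : ℂ) r, HasSum (fun n => a n * z ^ n) (g z) := by
  set a : ℕ → ℂ := fun n => (n.factorial : ℂ)⁻¹ * iteratedDeriv n g 0 with ha
  have h1 : ∀ z ∈ Metric.ball (0 : ℂ) r, HasSum (fun n => a n * z ^ n) (g z) := by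
    intro z hz
    have e : (fun n => a n * z ^ n) = fun n : ℕ =>
        (n.factorial : ℂ)⁻¹ • (z - 0) ^ n • iteratedDeriv n g 0 := by
      funext n
      simp only [ha, sub_zero, smul_eq_mul]
      ring
    rw [e]
    exact Complex.hasSum_taylorSeries_on_ball hg hz
  refine ⟨a, ?_, h1⟩
  have h2 := (h1 s₀ (by simpa [abs_of_nonneg h0] using hs)).summable.norm
  simpa [abs_of_nonneg h0] using h2

end Series

/-! ### The evolution equation for the reciprocal derivative p = 1/f'. -/

/-- `p` and `h` are analytic in `z` on the disk of radius `s`, satisfy `p_t = z (h p' - p h') - h p`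
there, and `Re h = |p|²` on the unit circle; `G` is the time derivative of `p`. -/
structure IsReciprocalSolution (b s : ℝ) (p h G : ℝ → ℂ → ℂ) : Prop where
  continuousOn_p : ContinuousOn (Function.uncurry p) (univ ×ˢ Metric.closedBall 0 s)
  continuousOn_h : ContinuousOn (Function.uncurry h) (univ ×ˢ Metric.closedBall 0 s)
  continuousOn_G : ContinuousOn (Function.uncurry G) (univ ×ˢ Metric.closedBall 0 s)
  hasDerivAt_p : ∀ t, ∀ z ∈ Metric.ball (0 : ℂ) s, HasDerivAt (p t) (deriv (p t) z) z
  hasDerivAt_h : ∀ t, ∀ z ∈ Metric.ball (0 : ℂ) s, HasDerivAt (h t) (deriv (h t) z) z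
  transport : ∀ t, ∀ z ∈ Metric.ball (0 : ℂ) s,
    G t z = h t z * (z * deriv (p t) z) - z * deriv (h t) z * p t z - h t z * p t z
  hasDerivWithinAt : ∀ z ∈ Metric.closedBall (0 : ℂ) s, ∀ t ∈ Icc 0 b,
    HasDerivWithinAt (fun τ => p τ z) (G t z) (Icc 0 b) t
  re_h : ∀ t z, ‖z‖ = 1 → (h t z).re = ‖p t z‖ ^ 2
  im_h_zero : ∀ t, (h t 0).im = 0

theorem exists_reciprocal_solution {p₀ : ℂ → ℂ} {r s₂ δ : ℝ}
    (hp₀ : DifferentiableOn ℂ p₀ (Metric.ball 0 r)) (hs₂ : 1 < s₂) (hr : s₂ < r) (hδ : 0 < δ) :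
    ∃ b > 0, ∃ p h G : ℝ → ℂ → ℂ, IsReciprocalSolution b s₂ p h G ∧
      (∀ z ∈ Metric.closedBall (0 : ℂ) s₂, p 0 z = p₀ z) ∧
      ∀ t, ∀ z ∈ Metric.closedBall (0 : ℂ) s₂, ‖p t z - p₀ z‖ ≤ δ := by
  -- Each radius costs one step: the Taylor series of p₀ is summable at s₀, the coefficient system
  -- is solved at s₁, and the transport term is controlled at s₂.
  obtain ⟨s₁, h21, h1r⟩ := exists_between hr
  obtain ⟨s₀, h10, h0r⟩ := exists_between h1r
  have hs₂0 : 0 < s₂ := by linarith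
  obtain ⟨a, ha, hsum⟩ := exists_summable_taylor hp₀ (by linarith : 0 ≤ s₀) h0r
  obtain ⟨b, hb, p, hpc, ⟨κ, hκ, hκb⟩, ⟨d, hd, hdδ, hdb⟩, hpi⟩ :=
    exists_coeff_solution (by linarith : 1 ≤ s₁) h10 ha hδ
  set h : ℕ → ℝ → ℂ := fun n t => herglotzCoeff 1 (fun k => p k t) (fun k => p k t) n with hh
  set G : ℕ → ℝ → ℂ := fun n t => transportCoeff (fun k => h k t) (fun k => p k t) n with hG
  obtain ⟨hhc, η, hη, hη0, hηb⟩ := continuous_herglotzCoeff (by linarith) hpc hκ hκb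
  obtain ⟨hGc, γ, hγ, hγb⟩ := continuous_transportCoeff hs₂0 h21 hhc hpc hη hη0 hκ hηb hκb
  have hsub : (univ : Set ℝ) ×ˢ Metric.closedBall (0 : ℂ) s₂ ⊆ univ ×ˢ Metric.closedBall 0 s₁ :=
    prod_mono subset_rfl (Metric.closedBall_subset_closedBall h21.le)
  have hball : Metric.ball (0 : ℂ) s₂ ⊆ Metric.ball 0 s₁ := Metric.ball_subset_ball h21.le
  have hz2 : ∀ z ∈ Metric.closedBall (0 : ℂ) s₂, ‖z‖ ≤ s₂ := fun z hz => by simpa using hz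
  have hz1 : ∀ z ∈ Metric.closedBall (0 : ℂ) s₂, ‖z‖ ≤ s₁ := fun z hz => (hz2 z hz).trans h21.le
  have hs : ∀ z ∈ Metric.closedBall (0 : ℂ) s₂, HasSum (fun n => a n * z ^ n) (p₀ z) :=
    fun z hz => hsum z (Metric.closedBall_subset_ball hr hz)
  have hp0 : ∀ n, p n 0 = a n := fun n => by
    have := hpi n 0 ⟨le_rfl, hb.le⟩
    simpa using this
  have hpn : ∀ t, Summable fun n => ‖p n t‖ := fun t =>
    hκ.of_nonneg_of_le (fun _ => norm_nonneg _) fun n =>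
      (le_mul_of_one_le_right (norm_nonneg _) (one_le_pow₀ (by linarith))).trans (hκb n t)
  refine ⟨b, hb, powerSum p, powerSum h, powerSum G, ⟨?_, ?_, ?_, ?_, ?_, ?_, ?_, ?_, ?_⟩, ?_, ?_⟩
  · exact (continuousOn_powerSum hpc hκ hκb).mono hsub
  · exact (continuousOn_powerSum hhc hη hηb).mono hsub
  · exact continuousOn_powerSum hGc hγ hγb
  · exact fun t z hz => (hasDerivAt_powerSum hκ hκb t (hball hz)).1
  · exact fun t z hz => (hasDerivAt_powerSum hη hηb t (hball hz)).1
  · intro t z hz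
    have d1 := (hasDerivAt_powerSum hκ hκb t (hball hz)).2
    have d2 := (hasDerivAt_powerSum hη hηb t (hball hz)).2
    have hz' := hz1 z (Metric.ball_subset_closedBall hz)
    have n1 : Summable fun n => ‖p n t * z ^ n‖ :=
      hκ.of_nonneg_of_le (fun _ => norm_nonneg _) fun n => norm_mul_pow_le hκb hz' n t
    have n2 : Summable fun n => ‖h n t * z ^ n‖ :=
      hη.of_nonneg_of_le (fun _ => norm_nonneg _) fun n => norm_mul_pow_le hηb hz' n t
    rw [← d1.tsum_eq, ← d2.tsum_eq]
    exact tsum_transportCoeff_mul_pow n2 n1 d2.summable.norm d1.summable.norm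
  · intro z hz t ht
    -- Termwise differentiation needs derivatives at all times, whereas p_n equals its integral
    -- formula only on [0, b]; hence the auxiliary P and the one-sided derivatives at the end
    -- points.
    let P : ℕ → ℝ → ℂ := fun n τ => a n + ∫ σ in (0 : ℝ)..τ, G n σ
    have hP : ∀ n τ, HasDerivAt (fun τ => P n τ * z ^ n) (G n τ * z ^ n) τ := fun n τ =>
      (((hGc n).integral_hasStrictDerivAt 0 τ).hasDerivAt.const_add (a n)).mul_const _
    have h1 := hasDerivAt_tsum hγ hP (fun n τ => norm_mul_pow_le hγb (hz2 z hz) n τ)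
      (y₀ := 0) (by simpa [P] using (hs z hz).summable) t
    refine h1.hasDerivWithinAt.congr (fun τ hτ => ?_) ?_
    · exact tsum_congr fun n => by rw [hpi n τ hτ]
    · exact tsum_congr fun n => by rw [hpi n t ht]
  · exact fun t z hz => re_tsum_herglotzCoeff_mul_pow hz (hpn t)
  · intro t
    have : powerSum h t 0 = h 0 t := by
      rw [powerSum, tsum_eq_single 0 (fun n hn => by simp [hn])]
      simp
    rw [this]
    exact im_herglotzCoeff_zero _ (hpn t)
  · intro z hz
    simp only [powerSum, hp0]
    exact (hs z hz).tsum_eq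
  · intro t z hz
    have n1 : Summable fun n => p n t * z ^ n :=
      Summable.of_norm_bounded hκ fun n => norm_mul_pow_le hκb (hz1 z hz) n t
    rw [powerSum, ← (hs z hz).tsum_eq, ← n1.tsum_sub (hs z hz).summable]
    refine (tsum_of_norm_bounded hd.hasSum fun n => ?_).trans hdδ
    rw [← sub_mul]
    exact norm_mul_pow_le (c := fun n t => p n t - a n) hdb (hz1 z hz) n t

/-! ### Regularity in time. -/

theorem IsC1.mono {b T : ℝ} {E : Set ℂ} {f : ℝ → ℂ → ℂ} (hf : IsC1 b E f) (hT : T ≤ b) :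
    IsC1 T E f := by
  obtain ⟨U, hU, hEU, g, h⟩ := hf
  have hsub : Icc 0 T ⊆ Icc 0 b := Icc_subset_Icc_right hT
  refine ⟨U, hU, hEU, g, fun t ht => ?_⟩
  obtain ⟨h1, h2, h3, h4⟩ := h t (hsub ht)
  refine ⟨h1, h2, fun u hu => ?_, fun u hu => ?_⟩
  · exact nhdsWithin_mono t (sdiff_subset_sdiff_left hsub) (h3 u hu)
  · exact nhdsWithin_mono t hsub (h4 u hu)

theorem isC1_of_hasDerivAt {b : ℝ} {E U K : Set ℂ} {f g : ℝ → ℂ → ℂ} (hU : IsOpen U)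
    (hEU : E ⊆ U) (hK : IsCompact K) (hUK : U ⊆ K)
    (hf : ∀ t ∈ Icc 0 b, AnalyticOnNhd ℂ (f t) U) (hg : ∀ t ∈ Icc 0 b, AnalyticOnNhd ℂ (g t) U)
    (hd : ∀ z ∈ U, ∀ t ∈ Icc 0 b, HasDerivWithinAt (fun τ => f τ z) (g t z) (Icc 0 b) t)
    (hgc : ContinuousOn (Function.uncurry g) (Icc 0 b ×ˢ K)) : IsC1 b E f := by
  -- Joint continuity and compactness of K make g(τ) → g(t) uniform in z.
  have hunif : ∀ t ∈ Icc 0 b, ∀ ε > 0, ∃ η > 0, ∀ τ ∈ Icc 0 b, |τ - t| < η →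
      ∀ z ∈ U, ‖g τ z - g t z‖ < ε := by
    intro t ht ε hε
    obtain ⟨v, hv, hvu⟩ := hK.mem_uniformity_of_prod hgc ht (Metric.dist_mem_uniformity hε)
    obtain ⟨η, hη, hηv⟩ := Metric.mem_nhdsWithin_iff.1 hv
    refine ⟨η, hη, fun τ hτ hτt z hz => ?_⟩
    have := hvu τ (hηv ⟨by simpa [Real.dist_eq] using hτt, hτ⟩) z (hUK hz)
    simpa [dist_eq_norm] using this
  refine ⟨U, hU, hEU, g, fun t ht => ⟨hf t ht, hg t ht, ?_, ?_⟩⟩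
  · rw [Metric.tendstoUniformlyOn_iff]
    intro ε hε
    obtain ⟨η, hη, hb⟩ := hunif t ht (ε / 2) (half_pos hε)
    rw [eventually_nhdsWithin_iff]
    filter_upwards [Metric.ball_mem_nhds t hη] with s hs hs' z hz
    have hconv : Convex ℝ (Icc 0 b ∩ Metric.ball t η) := (convex_Icc 0 b).inter (convex_ball t η)
    -- Mean value inequality for τ ↦ f(τ,z) - τ g(t,z), whose derivative g(τ,z) - g(t,z) is
    -- uniformly small.
    have h1 : ‖(f s z - s * g t z) - (f t z - t * g t z)‖ ≤ ε / 2 * ‖s - t‖ := by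
      refine hconv.norm_image_sub_le_of_norm_hasDerivWithin_le
        (f := fun τ : ℝ => f τ z - τ * g t z) (f' := fun τ => g τ z - g t z) ?_ ?_
        ⟨ht, Metric.mem_ball_self hη⟩ ⟨hs'.1, hs⟩
      · intro τ hτ
        have h2 : HasDerivAt (fun τ : ℝ => (τ : ℂ) * g t z) (g t z) τ := by
          simpa using (Complex.ofRealCLM.hasDerivAt (x := τ)).mul_const (g t z)
        exact ((hd z hz τ hτ.1).mono inter_subset_left).sub h2.hasDerivWithinAt
      · intro τ hτ
        exact (hb τ hτ.1 (by simpa [Real.dist_eq] using hτ.2) z hz).le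
    have hst : s - t ≠ 0 := sub_ne_zero.2 fun h => hs'.2 (by simp [h])
    have hst' : ((s - t : ℝ) : ℂ) ≠ 0 := by exact_mod_cast hst
    have h3 : 0 < ‖s - t‖ := norm_pos_iff.2 hst
    have h4 : (f s z - f t z) / ((s - t : ℝ) : ℂ) - g t z =
        ((f s z - s * g t z) - (f t z - t * g t z)) / ((s - t : ℝ) : ℂ) := by
      field_simp
      push_cast
      ring
    rw [dist_comm, dist_eq_norm, h4, norm_div, Complex.norm_real, div_lt_iff₀ h3]
    refine h1.trans_lt ?_
    nlinarith
  · rw [Metric.tendstoUniformlyOn_iff]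
    intro ε hε
    obtain ⟨η, hη, hb⟩ := hunif t ht ε hε
    rw [eventually_nhdsWithin_iff]
    filter_upwards [Metric.ball_mem_nhds t hη] with s hs hs' z hz
    rw [dist_comm, dist_eq_norm]
    exact hb s hs' (by simpa [Real.dist_eq] using hs) z hz

/-! ### Recovering the mapping function from p and h. -/

/-- The time derivative `z h / p` of the mapping function. -/
noncomputable def velocity (p h : ℝ → ℂ → ℂ) (t : ℝ) (z : ℂ) : ℂ := z * h t z / p t z

/-- The mapping function with initial value `f₀` and time derivative `velocity p h`. -/
noncomputable def evolution (f₀ : ℂ → ℂ) (p h : ℝ → ℂ → ℂ) (t : ℝ) (z : ℂ) : ℂ :=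
  f₀ z + ∫ τ in (0 : ℝ)..t, velocity p h τ z

namespace IsReciprocalSolution

variable {b s : ℝ} {p h G : ℝ → ℂ → ℂ}

theorem continuousOn_velocity (H : IsReciprocalSolution b s p h G)
    (hp : ∀ t, ∀ z ∈ Metric.closedBall (0 : ℂ) s, p t z ≠ 0) :
    ContinuousOn (Function.uncurry (velocity p h)) (univ ×ˢ Metric.closedBall 0 s) := by
  have : ContinuousOn (fun q : ℝ × ℂ => q.2 * Function.uncurry h q / Function.uncurry p q)
      (univ ×ˢ Metric.closedBall 0 s) :=
    (continuousOn_snd.mul H.continuousOn_h).div H.continuousOn_p fun q hq => hp q.1 q.2 hq.2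
  exact this

theorem continuous_section {F : ℝ → ℂ → ℂ}
    (hF : ContinuousOn (Function.uncurry F) (univ ×ˢ Metric.closedBall 0 s)) {z : ℂ}
    (hz : z ∈ Metric.closedBall (0 : ℂ) s) : Continuous fun t => F t z := by
  rw [← continuousOn_univ]
  exact hF.comp (f := fun t : ℝ => (t, z)) (by fun_prop) fun t _ => ⟨mem_univ _, hz⟩

theorem hasDerivAt_evolution_time (H : IsReciprocalSolution b s p h G)
    (hp : ∀ t, ∀ z ∈ Metric.closedBall (0 : ℂ) s, p t z ≠ 0) (f₀ : ℂ → ℂ) (t : ℝ) {z : ℂ}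
    (hz : z ∈ Metric.closedBall (0 : ℂ) s) :
    HasDerivAt (fun τ => evolution f₀ p h τ z) (velocity p h t z) t :=
  ((continuous_section (H.continuousOn_velocity hp) hz).integral_hasStrictDerivAt
    0 t).hasDerivAt.const_add _

/-- By the quotient rule and the transport equation, (z h/p)' = -p_t/p², which is the time
derivative of 1/p. -/
theorem hasDerivAt_velocity (H : IsReciprocalSolution b s p h G)
    (hp : ∀ t, ∀ z ∈ Metric.closedBall (0 : ℂ) s, p t z ≠ 0) (t : ℝ) {z : ℂ}
    (hz : z ∈ Metric.ball (0 : ℂ) s) :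
    HasDerivAt (velocity p h t) (-G t z / p t z ^ 2) z := by
  have hpz := hp t z (Metric.ball_subset_closedBall hz)
  have h1 := ((hasDerivAt_id z).mul (H.hasDerivAt_h t z hz)).div (H.hasDerivAt_p t z hz) hpz
  refine h1.congr_deriv ?_
  rw [H.transport t z hz]
  simp only [id, Pi.mul_apply]
  congr 1
  ring

/-- Differentiating under the integral produces ∫ ∂_τ(1/p) dτ, which telescopes to 1/p(t) - 1/p(0).
-/
theorem hasDerivAt_evolution (H : IsReciprocalSolution b s p h G)
    (hp : ∀ t, ∀ z ∈ Metric.closedBall (0 : ℂ) s, p t z ≠ 0) {f₀ : ℂ → ℂ} {t : ℝ}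
    (ht : t ∈ Icc 0 b) {z : ℂ} (hz : z ∈ Metric.ball (0 : ℂ) s)
    (hf₀ : HasDerivAt f₀ (p 0 z)⁻¹ z) :
    HasDerivAt (evolution f₀ p h t) (p t z)⁻¹ z := by
  have hzc := Metric.ball_subset_closedBall hz
  have hbs : ∀ {x : ℂ}, x ∈ Metric.ball (0 : ℂ) s → x ∈ Metric.closedBall (0 : ℂ) s :=
    fun hx => Metric.ball_subset_closedBall hx
  have hcD : ContinuousOn (Function.uncurry fun t z => -G t z / p t z ^ 2)
      (univ ×ˢ Metric.closedBall 0 s) := by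
    have : ContinuousOn (fun q : ℝ × ℂ => -Function.uncurry G q / Function.uncurry p q ^ 2)
        (univ ×ˢ Metric.closedBall 0 s) :=
      H.continuousOn_G.neg.div (H.continuousOn_p.pow 2)
        fun q hq => pow_ne_zero 2 (hp q.1 q.2 hq.2)
    exact this
  have hsub : Icc 0 b ×ˢ Metric.closedBall (0 : ℂ) s ⊆ univ ×ˢ Metric.closedBall 0 s :=
    prod_mono (subset_univ _) subset_rfl
  obtain ⟨C, hC⟩ := (isCompact_Icc.prod (isCompact_closedBall (0 : ℂ) s)).exists_bound_of_continuousOn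
    (hcD.mono hsub)
  have hV := H.continuousOn_velocity hp
  have hmem : ∀ τ ∈ uIoc 0 t, τ ∈ Icc 0 b := by
    intro τ hτ
    rw [uIoc_of_le ht.1] at hτ
    exact ⟨hτ.1.le, hτ.2.trans ht.2⟩
  have hD := (intervalIntegral.hasDerivAt_integral_of_dominated_loc_of_deriv_le
    (μ := MeasureTheory.volume) (a := 0) (b := t) (F := fun x τ => velocity p h τ x)
    (F' := fun x τ => -G τ x / p τ x ^ 2) (bound := fun _ => C) (x₀ := z)
    (Metric.isOpen_ball.mem_nhds hz)
    (by
      filter_upwards [Metric.isOpen_ball.mem_nhds hz] with x hx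
      exact (continuous_section hV (hbs hx)).aestronglyMeasurable)
    ((continuous_section hV hzc).intervalIntegrable _ _)
    (continuous_section hcD hzc).aestronglyMeasurable
    (.of_forall fun τ hτ x hx => hC (τ, x) ⟨hmem τ hτ, hbs hx⟩)
    (by simp)
    (.of_forall fun τ _ x hx => H.hasDerivAt_velocity hp τ hx)).2
  have hI : ∫ τ in (0 : ℝ)..t, -G τ z / p τ z ^ 2 = (p t z)⁻¹ - (p 0 z)⁻¹ := by
    refine intervalIntegral.integral_eq_sub_of_hasDerivAt_of_le (f := fun τ => (p τ z)⁻¹) ht.1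
      ?_ ?_ ((continuous_section hcD hzc).intervalIntegrable _ _)
    · exact ((continuous_section H.continuousOn_p hzc).inv₀ fun τ => hp τ z hzc).continuousOn
    · intro τ hτ
      have h1 : τ ∈ Icc 0 b := ⟨hτ.1.le, hτ.2.le.trans ht.2⟩
      have h2 := (H.hasDerivWithinAt z hzc τ h1).hasDerivAt
        (Icc_mem_nhds hτ.1 (hτ.2.trans_le ht.2))
      exact h2.inv (hp τ z hzc)
  rw [hI] at hD
  exact (hf₀.add hD).congr_deriv (by ring)

/-- At z = 0 the equation is p_t = -h p with h real, so Im p solves a linear homogeneous equation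
and Grönwall's inequality applies. -/
theorem im_p_zero (H : IsReciprocalSolution b s p h G) (hs : 0 < s) (h0 : (p 0 0).im = 0) :
    ∀ t ∈ Icc 0 b, (p t 0).im = 0 := by
  have hz : (0 : ℂ) ∈ Metric.ball (0 : ℂ) s := Metric.mem_ball_self hs
  have hzc := Metric.ball_subset_closedBall hz
  obtain ⟨K, hK⟩ := (isCompact_Icc (a := (0 : ℝ)) (b := b)).exists_bound_of_continuousOn
    (continuous_section H.continuousOn_h hzc).continuousOn
  have hG : ∀ t, (G t 0).im = -((h t 0).re * (p t 0).im) := by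
    intro t
    rw [H.transport t 0 hz]
    simp [H.im_h_zero t]
  refine eq_zero_of_abs_deriv_le_mul_abs_self_of_eq_zero_right (f' := fun t => (G t 0).im)
    (K := K) ?_ ?_ h0 ?_
  · exact (Complex.continuous_im.comp (continuous_section H.continuousOn_p hzc)).continuousOn
  · intro t ht
    have h1 : HasDerivWithinAt (fun τ => p τ 0) (G t 0) (Ici t) t := by
      refine ((H.hasDerivWithinAt 0 hzc t ⟨ht.1, ht.2.le⟩).mono_of_mem_nhdsWithin ?_)
      exact mem_of_superset (Icc_mem_nhdsGE ht.2) (Icc_subset_Icc_left ht.1)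
    exact Complex.imCLM.hasFDerivAt.comp_hasDerivWithinAt t h1
  · intro t ht
    rw [hG, norm_neg, norm_mul]
    refine mul_le_mul_of_nonneg_right ?_ (norm_nonneg _)
    exact (Complex.abs_re_le_norm _).trans (hK t ⟨ht.1, ht.2.le⟩)

/-- Since |ξ| = 1 the product equals h/|p|², and Re h = |p|² there. -/
theorem re_velocity_mul_conj (H : IsReciprocalSolution b s p h G) {t : ℝ} {ξ : ℂ} (hξ : ‖ξ‖ = 1)
    (hp : p t ξ ≠ 0) :
    (velocity p h t ξ * (starRingEnd ℂ) ((p t ξ)⁻¹ * ξ)).re = 1 := by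
  have h1 : velocity p h t ξ * (starRingEnd ℂ) ((p t ξ)⁻¹ * ξ) =
      h t ξ * ((‖p t ξ‖ ^ 2 : ℝ) : ℂ)⁻¹ := by
    have e1 := Complex.mul_conj' ξ
    have e2 := Complex.mul_conj' (p t ξ)
    rw [hξ, Complex.ofReal_one] at e1
    push_cast
    rw [← e2, velocity, map_mul, map_inv₀, mul_inv, div_eq_mul_inv]
    linear_combination (h t ξ * (p t ξ)⁻¹ * ((starRingEnd ℂ) (p t ξ))⁻¹) * e1
  rw [h1, ← Complex.ofReal_inv, Complex.re_mul_ofReal, H.re_h t ξ hξ]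
  exact mul_inv_cancel₀ (by positivity)

end IsReciprocalSolution

/-! ### Construction of strong solutions. -/

theorem exists_local_solution {f₀ : ℂ → ℂ} {r s : ℝ} (hs : 1 < s) (hsr : s < r)
    (hf₀ : AnalyticOnNhd ℂ f₀ (Metric.ball 0 r)) (hinj : InjOn f₀ (Metric.ball 0 r))
    (hn : Normalized f₀) :
    ∃ b > 0, ∃ f : ℝ → ℂ → ℂ, f 0 = f₀ ∧
      (∀ t ∈ Icc 0 b, AnalyticOnNhd ℂ (f t) (Metric.ball 0 s) ∧ InjOn (f t) (Metric.ball 0 s) ∧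
        Normalized (f t)) ∧
      (∀ E ⊆ Metric.ball (0 : ℂ) s, IsC1 b E f) ∧
      ∀ t ∈ Icc 0 b, ∀ ξ : ℂ, ‖ξ‖ = 1 → ∃ v, HasDerivAt (fun τ => f τ ξ) v t ∧
        (v * (starRingEnd ℂ) (deriv (f t) ξ * ξ)).re = 1 := by
  have hs0 : 0 < s := by linarith
  have hcb : Metric.closedBall (0 : ℂ) s ⊆ Metric.ball 0 r := Metric.closedBall_subset_ball hsr
  have hpre : IsPreconnected (Metric.ball (0 : ℂ) r) := (convex_ball _ _).isPreconnected
  have hd0 : ∀ z ∈ Metric.ball (0 : ℂ) r, deriv f₀ z ≠ 0 := fun z hz =>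
    deriv_ne_zero_of_injOn Metric.isOpen_ball hpre hf₀ hinj hz
  set p₀ : ℂ → ℂ := fun z => (deriv f₀ z)⁻¹ with hp₀
  have hp₀d : DifferentiableOn ℂ p₀ (Metric.ball 0 r) := fun z hz =>
    ((hf₀ z hz).deriv.differentiableAt.inv (hd0 z hz)).differentiableWithinAt
  have hp₀0 : ∀ z ∈ Metric.ball (0 : ℂ) r, p₀ z ≠ 0 := fun z hz => inv_ne_zero (hd0 z hz)
  have hK := isCompact_closedBall (0 : ℂ) s
  obtain ⟨c, hc, hcK⟩ := exists_mul_norm_sub_le_of_injOn Metric.isOpen_ball hpre hf₀ hinj hK hcb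
  obtain ⟨m, hm, hmK⟩ : ∃ m > 0, ∀ z ∈ Metric.closedBall (0 : ℂ) s, m ≤ ‖p₀ z‖ := by
    obtain ⟨w, hw, hwm⟩ := hK.exists_isMinOn ⟨0, Metric.mem_closedBall_self hs0.le⟩
      (hp₀d.continuousOn.mono hcb).norm
    exact ⟨‖p₀ w‖, norm_pos_iff.2 (hp₀0 w (hcb hw)), fun z hz => hwm hz⟩
  -- The bound m/2 keeps |p| ≥ m/2 and Re p(t,0) > 0. Since |p(t)||p(0)| ≥ m²/2, the bound c m²/4
  -- gives |1/p(t) - 1/p(0)| ≤ c/2 < c, as stability of injectivity requires.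
  set δ := min (m / 2) (c * m ^ 2 / 4) with hδ
  have hδ0 : 0 < δ := by positivity
  have hδm : δ ≤ m / 2 := min_le_left _ _
  have hδc : δ ≤ c * m ^ 2 / 4 := min_le_right _ _
  obtain ⟨b, hb, p, h, G, H, hp0, hpδ⟩ := exists_reciprocal_solution hp₀d hs hsr hδ0
  have hpm : ∀ t, ∀ z ∈ Metric.closedBall (0 : ℂ) s, m / 2 ≤ ‖p t z‖ := by
    intro t z hz
    have h1 := hpδ t z hz
    have h2 := hmK z hz
    have h3 := norm_sub_norm_le (p₀ z) (p t z)
    rw [norm_sub_rev] at h3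
    linarith
  have hp : ∀ t, ∀ z ∈ Metric.closedBall (0 : ℂ) s, p t z ≠ 0 := fun t z hz =>
    norm_pos_iff.1 ((half_pos hm).trans_le (hpm t z hz))
  have hbc : Metric.ball (0 : ℂ) s ⊆ Metric.closedBall 0 s := Metric.ball_subset_closedBall
  have hf₀' : ∀ z ∈ Metric.ball (0 : ℂ) s, HasDerivAt f₀ (p 0 z)⁻¹ z := by
    intro z hz
    rw [hp0 z (hbc hz), hp₀, inv_inv]
    exact (hf₀ z (hcb (hbc hz))).differentiableAt.hasDerivAt
  have hf' : ∀ t ∈ Icc 0 b, ∀ z ∈ Metric.ball (0 : ℂ) s,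
      HasDerivAt (evolution f₀ p h t) (p t z)⁻¹ z := fun t ht z hz =>
    H.hasDerivAt_evolution hp ht hz (hf₀' z hz)
  have han : ∀ t ∈ Icc 0 b, AnalyticOnNhd ℂ (evolution f₀ p h t) (Metric.ball 0 s) :=
    fun t ht => DifferentiableOn.analyticOnNhd
      (fun z hz => (hf' t ht z hz).differentiableAt.differentiableWithinAt) Metric.isOpen_ball
  have h0s : (0 : ℂ) ∈ Metric.ball (0 : ℂ) s := Metric.mem_ball_self hs0
  refine ⟨b, hb, evolution f₀ p h, ?_, fun t ht => ⟨han t ht, ?_, ?_, ?_⟩, fun E hE => ?_, ?_⟩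
  · ext z; simp [evolution]
  · refine injOn_of_deriv_close (f₀ := f₀) (convex_ball (0 : ℂ) s)
      (fun z hz w hw => hcK z (hbc hz) w (hbc hw)) hf₀' (hf' t ht) (η := c / 2) ?_ (by linarith)
    intro z hz
    have h1 := hp t z (hbc hz)
    have h2 := hp 0 z (hbc hz)
    have h3 : (p t z)⁻¹ - (p 0 z)⁻¹ = (p 0 z - p t z) / (p t z * p 0 z) := by
      field_simp
    have h4 := hpδ t z (hbc hz)
    have h5 := hmK z (hbc hz)
    have h6 := hpm t z (hbc hz)
    rw [← hp0 z (hbc hz)] at h4 h5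
    rw [h3, norm_div, norm_mul, norm_sub_rev, div_le_iff₀ (by positivity)]
    have h7 : m / 2 * m ≤ ‖p t z‖ * ‖p 0 z‖ := mul_le_mul h6 h5 hm.le (norm_nonneg _)
    have h8 := mul_le_mul_of_nonneg_left h7 (half_pos hc).le
    linarith
  · simp [evolution, velocity, hn.1]
  · have hp00 : p 0 0 = (deriv f₀ 0)⁻¹ := hp0 0 (hbc h0s)
    have him0 : (p 0 0).im = 0 := by
      rw [hp00, Complex.inv_im, hn.2.1]; simp
    have him := H.im_p_zero hs0 him0 t ht
    -- The initial value at 0 is real and positive, so its real part is its modulus, at least m; the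
    -- perturbation is at most m/2.
    have hre0 : (p 0 0).re = ‖p₀ 0‖ := by
      have h1 : 0 ≤ (p 0 0).re := by
        rw [hp00, Complex.inv_re]
        exact div_nonneg hn.2.2.le (Complex.normSq_nonneg _)
      rw [← hp0 0 (hbc h0s), ← abs_of_nonneg h1]
      exact Complex.abs_re_eq_norm.2 him0
    have hre : 0 < (p t 0).re := by
      have h1 := (Complex.abs_re_le_norm _).trans (hpδ t 0 (hbc h0s))
      have h2 := hmK 0 (hbc h0s)
      rw [← hp0 0 (hbc h0s), Complex.sub_re, abs_le] at h1
      linarith [h1.1]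
    rw [(hf' t ht 0 h0s).deriv]
    refine ⟨by rw [Complex.inv_im, him]; simp, ?_⟩
    rw [Complex.inv_re]
    exact div_pos hre (Complex.normSq_pos.2 (hp t 0 (hbc h0s)))
  · refine isC1_of_hasDerivAt (g := velocity p h) Metric.isOpen_ball hE hK hbc han ?_ ?_ ?_
    · exact fun t _ => DifferentiableOn.analyticOnNhd (fun z hz =>
        (H.hasDerivAt_velocity hp t hz).differentiableAt.differentiableWithinAt) Metric.isOpen_ball
    · exact fun z hz t _ => (H.hasDerivAt_evolution_time hp f₀ t (hbc hz)).hasDerivWithinAt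
    · exact (H.continuousOn_velocity hp).mono (prod_mono (subset_univ _) subset_rfl)
  · intro t ht ξ hξ
    have hξs : ξ ∈ Metric.ball (0 : ℂ) s := by simpa [hξ] using hs
    refine ⟨_, H.hasDerivAt_evolution_time hp f₀ t (hbc hξs), ?_⟩
    rw [(hf' t ht ξ hξs).deriv]
    exact H.re_velocity_mul_conj hξ (hp t ξ (hbc hξs))

theorem exists_strong_solution {f₀ : ℂ → ℂ} {r r' : ℝ} (hr' : 1 < r') (hr : r' < r)
    (hf₀ : AnalyticOnNhd ℂ f₀ (Metric.ball 0 r)) (hinj : InjOn f₀ (Metric.ball 0 r))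
    (hn : Normalized f₀) :
    ∃ b > 0, ∃ f : ℝ → ℂ → ℂ, f 0 = f₀ ∧ IsStrongSolution (Icc 0 b) f ∧
      IsStrongSolution (Ico 0 b) f ∧ IsC1 b (closedDisk r') f ∧
      ∀ t ∈ Icc 0 b, f t ∈ O (closedDisk r') := by
  obtain ⟨s, hs', hsr⟩ := exists_between hr
  obtain ⟨b, hb, f, hf0, hf, hC1, heq⟩ :=
    exists_local_solution (hr'.trans hs') hsr hf₀ hinj hn
  have hsub : ∀ x < s, closedDisk x ⊆ Metric.ball 0 s := fun x hx =>
    Metric.closedBall_subset_ball hx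
  have hO : ∀ x < s, ∀ t ∈ Icc 0 b, f t ∈ O (closedDisk x) := fun x hx t ht =>
    ⟨⟨_, Metric.isOpen_ball, hsub x hx, (hf t ht).1, (hf t ht).2.1⟩, (hf t ht).2.2⟩
  -- The solution has a two-sided time derivative, which equals the derivative within any such I
  -- with unique differentiability; this serves both [0, b] and [0, b).
  have hsol : ∀ I ⊆ Icc 0 b, UniqueDiffOn ℝ I → IsStrongSolution I f := by
    intro I hI hu
    refine ⟨fun t ht => hO 1 (by linarith) t (hI ht),
      fun T hT => (hC1 _ (hsub 1 (by linarith))).mono (hI hT).2, fun t ht ξ hξ => ?_⟩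
    obtain ⟨v, hv, hre⟩ := heq t (hI ht) ξ hξ
    rwa [hv.hasDerivWithinAt.derivWithin (hu t ht)]
  exact ⟨b, hb, f, hf0, hsol _ subset_rfl (uniqueDiffOn_Icc hb),
    hsol _ Ico_subset_Icc_self (uniqueDiffOn_Ico 0 b), hC1 _ (hsub r' hs'), hO r' hs'⟩

end HeleShaw

theorem mainTheorem7 :
    (∀ (f₀ : ℂ → ℂ) (r ρ₀ : ℝ), 1 < r → r < ρ₀ →
      f₀ ∈ HeleShaw.H (HeleShaw.closedDisk ρ₀) →
      Set.InjOn f₀ (HeleShaw.closedDisk r) →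
      HeleShaw.Normalized f₀ →
      ∀ r' : ℝ, 1 < r' → r' < r →
        ∃ b : ℝ, 0 < b ∧ ∃ f : ℝ → ℂ → ℂ,
          Set.EqOn (f 0) f₀ (HeleShaw.closedDisk r') ∧
          HeleShaw.IsStrongSolution (Set.Icc 0 b) f ∧
          HeleShaw.IsC1 b (HeleShaw.closedDisk r') f ∧
          ∀ t ∈ Set.Icc 0 b, f t ∈ HeleShaw.O (HeleShaw.closedDisk r')) ∧
    (∀ f₀ ∈ HeleShaw.O (HeleShaw.closedDisk 1),
      ∃ b : ℝ, 0 < b ∧ ∃ f : ℝ → ℂ → ℂ,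
        Set.EqOn (f 0) f₀ (HeleShaw.closedDisk 1) ∧
        HeleShaw.IsStrongSolution (Set.Ico 0 b) f) := by
  constructor
  · intro f₀ r ρ₀ _ hrρ hf₀ hinj hn r' hr' hr
    have hsub : Metric.ball (0 : ℂ) r ⊆ HeleShaw.closedDisk r := Metric.ball_subset_closedBall
    obtain ⟨b, hb, f, hf0, hsol, -, hC1, hO⟩ := HeleShaw.exists_strong_solution hr' hr
      (fun z hz => hf₀ z (Metric.closedBall_subset_closedBall hrρ.le (hsub hz)))
      (hinj.mono hsub) hn
    exact ⟨b, hb, f, fun z _ => congrFun hf0 z, hsol, hC1, hO⟩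
  · rintro f₀ ⟨⟨U, hU, hEU, hf₀, hinj⟩, hn⟩
    -- Compactness of the closed unit disk puts the larger disk |z| < 1 + δ inside the domain of
    -- univalence.
    obtain ⟨δ, hδ, hδU⟩ := (isCompact_closedBall (0 : ℂ) 1).exists_thickening_subset_open hU hEU
    have hsub : Metric.ball (0 : ℂ) (1 + δ) ⊆ U := by
      rw [add_comm, ← thickening_closedBall hδ zero_le_one]
      exact hδU
    obtain ⟨b, hb, f, hf0, -, hsol, -, -⟩ := HeleShaw.exists_strong_solution
      (r := 1 + δ) (r' := 1 + δ / 2) (by linarith) (by linarith)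
      (fun z hz => hf₀ z (hsub hz)) (hinj.mono hsub) hn
    exact ⟨b, hb, f, fun z _ => congrFun hf0 z, hsol⟩
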